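/- **Setting.** Let $k$ be an even positive integer, let $n,d\ge 1$ be integers and $p\in[0,1]$. A random $k$-XOR instance $\Phi$ with probability $p$ on $n$ variables is obtained by sampling each of the $n^k$ tuples $S\in[n]^k$ independently with probability $p$ and including, for each sampled $S=(s_1,\dots,s_k)$, the constraint $\prod_{i=1}^k x_{s_i}=\eta_S$, where the $\eta_S$ are i.i.d. uniform on $\{\pm1\}$. Put $T_S=\eta_S$ if $S$ is sampled and $T_S=0$ otherwise. For $U,V\in[n]^{k/2}$ let $M_{U,V}=T_{(U,V)}$, where $(U,V)\in[n]^k$ is the concatenation, and let $S^{\Phi}=\frac12(M+M^\top)$. For $I=(U_1,\dots,U_d)$ and $J=(V_1,\dots,V_d)$ in $[n]^{kd/2}$, with $U_s,V_s\in[n]^{k/2}$, let $S^{\Phi,d}_{I,J}=\prod_{s=1}^d S^{\Phi}_{U_s,V_s}$, and define the $n^{kd/2}\times n^{kd/2}$ matrix $$R^{\Phi,d}_{I,J}=\frac{1}{((kd/2)!)^2}\sum_{\pi,\sigma}S^{\Phi,d}_{\pi(I),\sigma(J)},$$ where $\pi,\sigma$ range over all permutations of $\{1,\dots,kd/2\}$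 and $\pi(i_1,\dots,i_{kd/2})=(i_{\pi(1)},\dots,i_{\pi(kd/2)})$. For $I\in[n]^{kd/2}$ let $\mathrm{hist}(I)!=\prod_{i=1}^n\alpha_i!$, where $\alpha_i$ is the number of times $i$ appears in $I$, and let $D_{\mathrm{hist}}$ be the diagonal matrix with $(I,I)$-th entry $\sqrt{\mathrm{hist}(I)!}$. Put $$\widetilde R^{\Phi,d}=D_{\mathrm{hist}}^{-1}\,R^{\Phi,d}\,D_{\mathrm{hist}}^{-1},$$ and let $\|\cdot\|$ denote the spectral norm. **Corollary.** There is an absolute constant $c>0$ such that, for all $k,n,d,p$ as above with $d^{k/2-1}n^{k/2}p>1$, with probability at least $1-n^{-2}$ over the random $k$-XOR instance $\Phi$, $$\big\|\widetilde R^{\Phi,d}\big\|^{1/d}\;\le\; c\cdot\frac{e^{3k/4}}{(k/2)^{k/4}}\cdot\frac{n^{k/4}p^{1/2}}{d^{(k-2)/4}}\cdot\log n .$$ -/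

import Mathlib

open MeasureTheory

noncomputable section

namespace KXOR

/-- A `k`-XOR instance on `n` variables. For every `k`-tuple `S ∈ [n]^k` the value is `none` if no
constraint on `S` is present, and `some η` if the constraint `∏ i, x (S i) = η` is present. -/
abbrev XORInstance (n k : ℕ) : Type := (Fin k → Fin n) → Option ℤˣ

instance : MeasurableSpace (Option ℤˣ) := ⊤

/-- The law of the constraint on a single tuple: it is present with probability `p`, and if present
its sign is a fair coin flip. -/
def clauseLaw (p : ℝ) : Measure (Option ℤˣ) :=
  ENNReal.ofReal (1 - p) • Measure.dirac none +
    ENNReal.ofReal p • (ENNReal.ofReal (1 / 2) • Measure.dirac (some 1) +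
      ENNReal.ofReal (1 / 2) • Measure.dirac (some (-1)))

/-- The law of random `k`-XOR with probability `p`: independent over all `n ^ k` tuples. -/
def randomXOR (n k : ℕ) (p : ℝ) : Measure (XORInstance n k) :=
  Measure.pi fun _ => clauseLaw p

/-- The constraints tensor. -/
def tensor {n k : ℕ} (Φ : XORInstance n k) (S : Fin k → Fin n) : ℝ :=
  match Φ S with
  | none => 0
  | some η => ((η : ℤ) : ℝ)

/-- The concatenation of two `k/2`-tuples, `k` even. -/
def concat {n k : ℕ} (hk : Even k) (U V : Fin (k / 2) → Fin n) : Fin k → Fin n :=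
  Fin.append U V ∘ Fin.cast (by obtain ⟨r, rfl⟩ := hk; omega)

/-- The `n^(k/2) × n^(k/2)` flattening of the constraints tensor. -/
def flattening {n k : ℕ} (hk : Even k) (Φ : XORInstance n k) :
    Matrix (Fin (k / 2) → Fin n) (Fin (k / 2) → Fin n) ℝ :=
  Matrix.of fun U V => tensor Φ (concat hk U V)

/-- The symmetric matrix representation `(M + Mᵀ) / 2`. -/
def symRep {n k : ℕ} (hk : Even k) (Φ : XORInstance n k) :
    Matrix (Fin (k / 2) → Fin n) (Fin (k / 2) → Fin n) ℝ :=
  (1 / 2 : ℝ) • (flattening hk Φ + (flattening hk Φ).transpose)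

/-- The `s`-th of the `d` consecutive blocks of length `h` of a tuple of length `d * h`. -/
def block {n d h : ℕ} (I : Fin (d * h) → Fin n) (s : Fin d) : Fin h → Fin n :=
  fun i => I (finProdFinEquiv (s, i))

/-- The `d`-th Kronecker power of the symmetric matrix representation, indexed by `kd/2`-tuples. -/
def kroneckerPow {n k : ℕ} (hk : Even k) (d : ℕ) (Φ : XORInstance n k) :
    Matrix (Fin (d * (k / 2)) → Fin n) (Fin (d * (k / 2)) → Fin n) ℝ :=
  Matrix.of fun I J => ∏ s : Fin d, symRep hk Φ (block I s) (block J s)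

/-- The higher-order symmetric matrix representation `R^{Φ,d}`. -/
def higherSymRep {n k : ℕ} (hk : Even k) (d : ℕ) (Φ : XORInstance n k) :
    Matrix (Fin (d * (k / 2)) → Fin n) (Fin (d * (k / 2)) → Fin n) ℝ :=
  Matrix.of fun I J =>
    1 / ((d * (k / 2)).factorial : ℝ) ^ 2 *
      ∑ π : Equiv.Perm (Fin (d * (k / 2))), ∑ σ : Equiv.Perm (Fin (d * (k / 2))),
        kroneckerPow hk d Φ (I ∘ π) (J ∘ σ)

/-- The number of times that `i` appears in the tuple `I`. -/
def hist {n q : ℕ} (I : Fin q → Fin n) (i : Fin n) : ℕ :=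
  (Finset.univ.filter fun j => I j = i).card

/-- `hist(I)!`, the product of the factorials of the multiplicities. -/
def histFactorial {n q : ℕ} (I : Fin q → Fin n) : ℕ :=
  ∏ i : Fin n, (hist I i).factorial

/-- The diagonal matrix with entries `√(hist(I)!)`. -/
def histDiag (n q : ℕ) : Matrix (Fin q → Fin n) (Fin q → Fin n) ℝ :=
  Matrix.diagonal fun I => Real.sqrt (histFactorial I)

/-- The re-scaled matrix `D⁻¹ R^{Φ,d} D⁻¹`. -/
def rescaledRep {n k : ℕ} (hk : Even k) (d : ℕ) (Φ : XORInstance n k) :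
    Matrix (Fin (d * (k / 2)) → Fin n) (Fin (d * (k / 2)) → Fin n) ℝ :=
  (histDiag n (d * (k / 2)))⁻¹ * higherSymRep hk d Φ * (histDiag n (d * (k / 2)))⁻¹

/-- The spectral norm: the operator norm with respect to the Euclidean norm. -/
def spectralNorm {ι : Type*} [Fintype ι] [DecidableEq ι] (A : Matrix ι ι ℝ) : ℝ :=
  ‖Matrix.toEuclideanCLM (n := ι) (𝕜 := ℝ) A‖

end KXOR

end

/-! The proof is the trace moment method at a power of order `log n`. Write `R̃ = F K Fᵀ`, with `K`
the Kronecker power and `F` the `symmetrizer`, so that `tr R̃^L = tr (FᵀF K)^L`. Entries of `FᵀF`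
are nonnegative, vanish between tuples of different histograms and are at most `1/q!`, `q = d *
(k/2)` (`symmetrizer_gram_le`). Hence the trace is a sum over walks in which each row index has the
histogram of the preceding column index. In expectation only walks using every clause an even number
of times survive, with weight `p` per distinct clause (`integral_prod_tensor`).

Walks are counted by the set `N` of positions of first occurrences of clauses, at most half of all
`L * d`, and by a map sending each position to its representative (`sum_momentBound_le`). With `h =
k/2`, a step having `ν` new clauses has at most `n^(hν)` choices for their column halves and, the
row histogram being known, only `(hν)!` for their row halves (`card_clauses_le`). Against `1/q!`
this factorial gains `(e/q)^(q - hν)`.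

With `X = n^h p` and `Y = L d (e/(dh))^h`, each `N` contributes at most `X^|N| Y^(Ld - |N|)`. The
density hypothesis gives `Y ≤ B X` with `B` of order `log n`, so every term is at most `(B X
Y)^(Ld/2)` (`walkBound_le`). Both `B` and `Y` carry a factor of order `log n`, whence a single `log
n` after the square root. Markov's inequality finishes. -/

namespace KXOR

/-! ### Counting clauses and walks with prescribed histograms -/

/-- The number of functions with a prescribed weighted histogram, all weights being positive. -/
theorem card_le_factorial_of_weighted_hist {X ι : Type*} [DecidableEq X] [DecidableEq ι]
    (w : X → ℕ) (s : Finset X) (hw : ∀ x ∈ s, 0 < w x) (P : Finset (X → ι))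
    (hout : ∀ u ∈ P, ∀ u' ∈ P, ∀ x ∉ s, u x = u' x)
    (hP : ∀ u ∈ P, ∀ u' ∈ P, ∀ i,
      ∑ x ∈ s, (if u x = i then w x else 0) = ∑ x ∈ s, (if u' x = i then w x else 0)) :
    P.card ≤ s.card.factorial := by
  classical
  induction s using Finset.induction_on generalizing P with
  | empty =>
    simp only [Finset.card_empty, Nat.factorial_zero]
    refine Finset.card_le_one.2 fun u hu u' hu' => funext fun x => hout u hu u' hu' x (by simp)
  | insert x s hx ih =>
    rcases P.eq_empty_or_nonempty with rfl | ⟨u₀, hu₀⟩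
    · simp
    -- Since `w x > 0`, the value `u x` has positive weight in the common histogram, so it is
    -- already a value of the fixed `u₀` on `insert x s`.
    have himg : (P.image fun u => u x).card ≤ s.card + 1 := by
      have hsub : (P.image fun u => u x) ⊆ (insert x s).image u₀ := by
        intro j hj
        obtain ⟨u, hu, rfl⟩ := Finset.mem_image.1 hj
        have h1 := hP u hu u₀ hu₀ (u x)
        have h2 : 0 < ∑ y ∈ insert x s, (if u y = u x then w y else 0) := by
          rw [Finset.sum_insert hx, if_pos rfl]
          exact Nat.add_pos_left (hw x (by simp)) _
        rw [h1] at h2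
        obtain ⟨y, hy, hy'⟩ := Finset.exists_ne_zero_of_sum_ne_zero h2.ne'
        refine Finset.mem_image.2 ⟨y, hy, ?_⟩
        by_contra hne
        exact hy' (if_neg hne)
      refine (Finset.card_le_card hsub).trans (Finset.card_image_le.trans ?_)
      rw [Finset.card_insert_of_notMem hx]
    have hfib := Finset.card_le_mul_card_image (f := fun u : X → ι => u x) P s.card.factorial
      (fun j _ => by
        refine ih (fun y hy => hw y (by simp [hy])) _ ?_ ?_
        · intro u hu u' hu' y hy
          simp only [Finset.mem_filter] at hu hu'
          by_cases hyx : y = x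
          · rw [hyx, hu.2, hu'.2]
          · exact hout u hu.1 u' hu'.1 y (by simp [hyx, hy])
        · intro u hu u' hu' i
          simp only [Finset.mem_filter] at hu hu'
          have h1 := hP u hu.1 u' hu'.1 i
          rw [Finset.sum_insert hx, Finset.sum_insert hx, hu.2, hu'.2] at h1
          exact Nat.add_left_cancel h1)
    rw [Finset.card_insert_of_notMem hx, Nat.factorial_succ, mul_comm]
    exact hfib.trans (Nat.mul_le_mul_left _ himg)

/-- Counting sequences one letter at a time. -/
theorem card_le_prod_of_card_extensions_le {A : Type*} [DecidableEq A] {L : ℕ}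
    (P : Finset (Fin L → A)) (B : Fin L → ℕ)
    (hP : ∀ i, ∀ w₀ ∈ P, ((P.filter fun w => ∀ j < i, w j = w₀ j).image fun w => w i).card ≤ B i) :
    P.card ≤ ∏ i, B i := by
  classical
  induction L with
  | zero =>
    simp only [Finset.univ_eq_empty, Finset.prod_empty]
    exact Finset.card_le_one.2 fun u _ u' _ => Subsingleton.elim _ _
  | succ L ih =>
    have hfib := Finset.card_le_mul_card_image (f := fun w : Fin (L + 1) → A => Fin.init w) P
      (B (Fin.last L)) (fun j hj => by
        obtain ⟨w₀, hw₀, rfl⟩ := Finset.mem_image.1 hj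
        refine le_trans (le_of_eq ?_) (hP (Fin.last L) w₀ hw₀)
        have hfilt : (P.filter fun w : Fin (L + 1) → A => Fin.init w = Fin.init w₀) =
            P.filter fun w => ∀ j < Fin.last L, w j = w₀ j := by
          refine Finset.filter_congr fun w _ => ?_
          refine ⟨fun h j hj => ?_, fun h => funext fun j => h _ (Fin.castSucc_lt_last j)⟩
          obtain ⟨j, rfl⟩ := Fin.exists_castSucc_eq.2 hj.ne
          exact congrFun h j
        rw [← hfilt]
        refine (Finset.card_image_of_injOn ?_).symm
        intro w hw w' hw' h
        simp only [Finset.coe_filter, Set.mem_ofPred_eq] at hw hw'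
        rw [← Fin.snoc_init_self w, ← Fin.snoc_init_self w', hw.2, hw'.2]
        congr 1)
    rw [Fin.prod_univ_castSucc, mul_comm]
    refine hfib.trans (Nat.mul_le_mul_left _ (ih _ _ ?_))
    intro i v₀ hv₀
    obtain ⟨w₀, hw₀, rfl⟩ := Finset.mem_image.1 hv₀
    refine le_trans (Finset.card_le_card ?_) (hP i.castSucc w₀ hw₀)
    intro a ha
    simp only [Finset.mem_image, Finset.mem_filter] at ha ⊢
    obtain ⟨_, ⟨⟨w, hw, rfl⟩, h⟩, rfl⟩ := ha
    refine ⟨w, ⟨hw, fun j hj => ?_⟩, rfl⟩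
    obtain ⟨j, rfl⟩ := Fin.exists_castSucc_eq.2 (hj.trans (Fin.castSucc_lt_last i)).ne
    exact h j (by simpa using hj)

/-- One of the two halves of a clause. -/
def half {T : Type*} (b : Bool) (c : T × T) : T := if b then c.1 else c.2

theorem half_ext {T : Type*} {b : Bool} {c c' : T × T} (h : half b c = half b c')
    (h' : half (!b) c = half (!b) c') : c = c' := by
  cases b <;> simp_all [half, Prod.ext_iff]

/-- The joint histogram of the selected halves of `d` clauses. -/
def halfHist {n d h : ℕ} (b : Fin d → Bool) (a : Fin d → (Fin h → Fin n) × (Fin h → Fin n))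
    (i : Fin n) : ℕ :=
  ∑ s, ∑ j, if half (b s) (a s) j = i then 1 else 0

/-- Lists of `d` clauses with a prescribed histogram of selected halves, in which the clauses
outside `N` are prescribed or repeat clauses in `N`. -/
theorem card_clauses_le {n d h : ℕ} (b : Fin d → Bool) (N : Finset (Fin d))
    (P : Finset (Fin d → (Fin h → Fin n) × (Fin h → Fin n)))
    (hhist : ∀ a ∈ P, ∀ a' ∈ P, halfHist b a = halfHist b a')
    (hN : ∀ s ∉ N, (∀ a ∈ P, ∀ a' ∈ P, a s = a' s) ∨ ∃ s' ∈ N, ∀ a ∈ P, a s = a s') :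
    P.card ≤ n ^ (h * N.card) * (h * N.card).factorial := by
  classical
  set D : Finset (Fin d) := Finset.univ.filter fun s => s ∉ N ∧ ∀ a ∈ P, ∀ a' ∈ P, a s = a' s
  -- `D` holds the positions outside `N` whose clause is constant on `P`; `r` sends every other
  -- position to a representative in `N`.
  have hr : ∀ s, ∃ s', (s ∈ N → s' = s) ∧ (s ∉ D → s' ∈ N ∧ ∀ a ∈ P, a s = a s') := by
    intro s
    by_cases hs : s ∈ N
    · exact ⟨s, fun _ => rfl, fun _ => ⟨hs, fun _ _ => rfl⟩⟩
    · rcases hN s hs with h1 | ⟨s', hs', h2⟩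
      · exact ⟨s, fun _ => rfl, fun h =>
          absurd (Finset.mem_filter.2 ⟨Finset.mem_univ _, hs, h1⟩) h⟩
      · exact ⟨s', fun h => absurd h hs, fun _ => ⟨hs', h2⟩⟩
  choose r hrN hrD using hr
  have hDN : ∀ s ∈ N, s ∉ D := fun s hs h => (Finset.mem_filter.1 h).2.1 hs
  have hDc : ∀ s ∈ D, ∀ a ∈ P, ∀ a' ∈ P, a s = a' s := fun s h => (Finset.mem_filter.1 h).2.2
  -- The unselected halves on `N` cost `n ^ (h * N.card)`. Once they are fixed, only the selected
  -- halves on `N` vary, and these are controlled by the histogram.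
  have hfib := Finset.card_le_mul_card_image
    (f := fun a : Fin d → (Fin h → Fin n) × (Fin h → Fin n) =>
      fun s : N => half (!b s) (a s)) P (h * N.card).factorial (fun v hv => by
    set Q := P.filter fun a => (fun s : N => half (!b s) (a s)) = v
    have hQP : ∀ a ∈ Q, a ∈ P := fun a ha => (Finset.mem_filter.1 ha).1
    have hQv : ∀ a ∈ Q, ∀ a' ∈ Q, ∀ s ∈ N, half (!b s) (a s) = half (!b s) (a' s) :=
      fun a ha a' ha' s hs => by
        have h1 := congrFun (Finset.mem_filter.1 ha).2 ⟨s, hs⟩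
        have h2 := congrFun (Finset.mem_filter.1 ha').2 ⟨s, hs⟩
        exact h1.trans h2.symm
    rcases Q.eq_empty_or_nonempty with hQ | ⟨a₀, ha₀⟩
    · rw [hQ]; simp
    let u : (Fin d → (Fin h → Fin n) × (Fin h → Fin n)) → Fin d × Fin h → Fin n :=
      fun a x => if x.1 ∈ N then half (b x.1) (a x.1) x.2 else half (b x.1) (a₀ x.1) x.2
    have huinj : Set.InjOn u Q := by
      intro a ha a' ha' haa
      have hNeq : ∀ s ∈ N, a s = a' s := by
        intro s hs
        refine half_ext (b := b s) (funext fun j => ?_) (hQv a ha a' ha' s hs)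
        have := congrFun haa (s, j)
        simpa [u, hs] using this
      funext s
      by_cases hs : s ∈ D
      · exact hDc s hs a (hQP a ha) a' (hQP a' ha')
      · rw [(hrD s hs).2 a (hQP a ha), (hrD s hs).2 a' (hQP a' ha')]
        exact hNeq _ (hrD s hs).1
    rw [← Finset.card_image_of_injOn huinj]
    -- A repeat with the orientation of its representative selects the same, still unknown, half;
    -- with the opposite orientation it selects the half already fixed in `Q`. So only `G`
    -- contributes to the unknown part of the histogram, with weight `w` the number of such repeats.
    let G : Finset (Fin d) := Finset.univ.filter fun s => s ∉ D ∧ b s = b (r s)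
    let w : Fin d × Fin h → ℕ := fun x => (G.filter fun s => r s = x.1).card
    have key : ∀ a ∈ Q, ∀ i, halfHist b a i =
        (∑ s ∈ Gᶜ, ∑ j, if half (b s) (a₀ s) j = i then 1 else 0) +
          ∑ x ∈ N ×ˢ Finset.univ, (if u a x = i then w x else 0) := by
      intro a ha i
      rw [halfHist, ← Finset.sum_compl_add_sum G]
      congr 1
      · refine Finset.sum_congr rfl fun s hs => ?_
        have : half (b s) (a s) = half (b s) (a₀ s) := by
          by_cases hsD : s ∈ D
          · rw [hDc s hsD a (hQP a ha) a₀ (hQP a₀ ha₀)]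
          · have hb : b s = !b (r s) := by
              have : ¬ b s = b (r s) := fun hb =>
                (Finset.mem_compl.1 hs) (Finset.mem_filter.2 ⟨Finset.mem_univ _, hsD, hb⟩)
              cases h1 : b s <;> cases h2 : b (r s) <;> simp_all
            rw [(hrD s hsD).2 a (hQP a ha), (hrD s hsD).2 a₀ (hQP a₀ ha₀), hb]
            exact hQv a ha a₀ ha₀ _ (hrD s hsD).1
        rw [this]
      · have hGN : ∀ s ∈ G, r s ∈ N := fun s hs => (hrD s (Finset.mem_filter.1 hs).2.1).1
        rw [Finset.sum_product, ← Finset.sum_fiberwise_of_maps_to hGN]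
        refine Finset.sum_congr rfl fun s' hs' => ?_
        rw [Finset.sum_comm]
        refine Finset.sum_congr rfl fun j _ => ?_
        rw [Finset.sum_congr rfl (g := fun _ => if u a (s', j) = i then 1 else 0)]
        · rw [Finset.sum_const]
          split_ifs <;> simp [w]
        · intro s hs
          obtain ⟨hsG, rfl⟩ := Finset.mem_filter.1 hs
          have := (Finset.mem_filter.1 hsG).2
          rw [(hrD s this.1).2 a (hQP a ha), this.2]
          simp [u, hs']
    have hcard : (N ×ˢ (Finset.univ : Finset (Fin h))).card = h * N.card := by
      rw [Finset.card_product, Finset.card_univ, Fintype.card_fin, mul_comm]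
    rw [← hcard]
    refine card_le_factorial_of_weighted_hist w _ ?_ _ ?_ ?_
    -- The weights are positive because each position of `N` represents itself.
    · intro x hx
      have hxN := (Finset.mem_product.1 hx).1
      refine Finset.card_pos.2 ⟨x.1, Finset.mem_filter.2 ⟨Finset.mem_filter.2
        ⟨Finset.mem_univ _, hDN _ hxN, ?_⟩, hrN _ hxN⟩⟩
      rw [hrN _ hxN]
    · intro u₁ hu₁ u₂ hu₂ x hx
      obtain ⟨a, _, rfl⟩ := Finset.mem_image.1 hu₁
      obtain ⟨a', _, rfl⟩ := Finset.mem_image.1 hu₂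
      have hxN : x.1 ∉ N := fun h => hx (Finset.mem_product.2 ⟨h, Finset.mem_univ _⟩)
      simp [u, hxN]
    · intro u₁ hu₁ u₂ hu₂ i
      obtain ⟨a, ha, rfl⟩ := Finset.mem_image.1 hu₁
      obtain ⟨a', ha', rfl⟩ := Finset.mem_image.1 hu₂
      have h1 := congrFun (hhist a (hQP a ha) a' (hQP a' ha')) i
      rw [key a ha i, key a' ha' i] at h1
      exact Nat.add_left_cancel h1)
  refine hfib.trans ?_
  rw [mul_comm]
  refine Nat.mul_le_mul_right _ ((Finset.card_le_univ _).trans (le_of_eq ?_))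
  simp [pow_mul]

theorem card_eq_sum_card_section {L d : ℕ} (N : Finset (Fin L × Fin d)) :
    N.card = ∑ i : Fin L, (Finset.univ.filter fun s => (i, s) ∈ N).card := by
  classical
  rw [Finset.card_eq_sum_card_fiberwise (f := Prod.fst) (t := Finset.univ) (by simp)]
  refine Finset.sum_congr rfl fun i _ => ?_
  refine Finset.card_bij' (fun x _ => x.2) (fun s _ => (i, s)) ?_ ?_ ?_ ?_
  · rintro ⟨j, s⟩ hx
    obtain ⟨h1, rfl⟩ := Finset.mem_filter.1 hx
    simpa using h1
  · intro s hs
    simpa using hs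
  · rintro ⟨j, s⟩ hx
    obtain ⟨h1, rfl⟩ := Finset.mem_filter.1 hx
    rfl
  · intro s hs
    rfl

/-- Walks of `L` lists of `d` clauses such that the histogram of the selected halves of each list
is determined by the preceding lists, and in which each clause repeats an earlier or simultaneous
clause with position in `N`. -/
theorem card_walks_le {n d h L : ℕ} (b : Fin L × Fin d → Bool) (N : Finset (Fin L × Fin d))
    (g : Fin L × Fin d → Fin L × Fin d)
    (P : Finset (Fin L → Fin d → (Fin h → Fin n) × (Fin h → Fin n)))
    (hhist : ∀ i, ∀ w ∈ P, ∀ w' ∈ P, (∀ j < i, w j = w' j) →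
      halfHist (fun s => b (i, s)) (w i) = halfHist (fun s => b (i, s)) (w' i))
    (hg : ∀ w ∈ P, ∀ x, w x.1 x.2 = w (g x).1 (g x).2 ∧ g x ∈ N ∧ (g x).1 ≤ x.1) :
    P.card ≤ n ^ (h * N.card) *
      ∏ i, (h * (Finset.univ.filter fun s => (i, s) ∈ N).card).factorial := by
  rw [card_eq_sum_card_section N, Finset.mul_sum, ← Finset.prod_pow_eq_pow_sum,
    ← Finset.prod_mul_distrib]
  refine card_le_prod_of_card_extensions_le P _ fun i w₀ hw₀ => ?_
  refine card_clauses_le (fun s => b (i, s)) _ _ ?_ ?_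
  · intro a ha a' ha'
    obtain ⟨w, hw, rfl⟩ := Finset.mem_image.1 ha
    obtain ⟨w', hw', rfl⟩ := Finset.mem_image.1 ha'
    rw [Finset.mem_filter] at hw hw'
    exact hhist i w hw.1 w' hw'.1 fun j hj => (hw.2 j hj).trans (hw'.2 j hj).symm
  · intro s hs
    -- A representative in an earlier list makes the clause prescribed; one in the same list makes
    -- it a repeat within the section of `N`.
    rcases (hg w₀ hw₀ (i, s)).2.2.lt_or_eq with hlt | heq
    · left
      intro a ha a' ha'
      obtain ⟨w, hw, rfl⟩ := Finset.mem_image.1 ha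
      obtain ⟨w', hw', rfl⟩ := Finset.mem_image.1 ha'
      rw [Finset.mem_filter] at hw hw'
      have h1 := (hg w hw.1 (i, s)).1
      have h2 := (hg w' hw'.1 (i, s)).1
      simp only at h1 h2 hlt ⊢
      rw [h1, h2, hw.2 _ hlt, hw'.2 _ hlt]
    · right
      refine ⟨(g (i, s)).2, ?_, ?_⟩
      · have := (hg w₀ hw₀ (i, s)).2.1
        simp only at heq
        rw [Finset.mem_filter]
        refine ⟨Finset.mem_univ _, ?_⟩
        rwa [show (i, (g (i, s)).2) = g (i, s) from Prod.ext heq.symm rfl]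
      · intro a ha
        obtain ⟨w, hw, rfl⟩ := Finset.mem_image.1 ha
        rw [Finset.mem_filter] at hw
        have h1 := (hg w hw.1 (i, s)).1
        simp only at h1 heq
        rw [heq] at h1
        exact h1

/-! ### Summing moments over walks -/

/-- The number of positions at which a family takes a given value. -/
def mult {X E : Type*} [Fintype X] [DecidableEq E] (c : X → E) (e : E) : ℕ :=
  (Finset.univ.filter fun x => c x = e).card

/-- The moment bound of a product of clauses. -/
noncomputable def momentBound {X E : Type*} [Fintype X] [DecidableEq E] (p : ℝ) (c : X → E) : ℝ :=
  open Classical in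
  if ∀ e, Even (mult c e) then p ^ (Finset.univ.image c).card else 0

/-- Representatives of the clauses of a walk, with the least possible first coordinates. -/
theorem exists_representatives {L d : ℕ} {E : Type*} [DecidableEq E] (c : Fin L × Fin d → E) :
    ∃ g : Fin L × Fin d → Fin L × Fin d, (∀ x, c (g x) = c x) ∧ (∀ x y, c x = c y → g x = g y) ∧
      (∀ x, (g x).1 ≤ x.1) := by
  classical
  -- Choosing per value rather than per position makes equal clauses share a representative; `none`
  -- serves the values never taken.
  have h : ∀ e : E, ∃ y : Option (Fin L × Fin d), ∀ x, c x = e →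
      ∃ z, y = some z ∧ c z = e ∧ z.1 ≤ x.1 := by
    intro e
    rcases (Finset.univ.filter fun x => c x = e).eq_empty_or_nonempty with he | he
    · refine ⟨none, fun x hx => ?_⟩
      have : x ∈ Finset.univ.filter fun x => c x = e := by simpa using hx
      rw [he] at this
      simp at this
    · obtain ⟨z, hz, hmin⟩ := Finset.exists_min_image _ Prod.fst he
      exact ⟨some z, fun x hx => ⟨z, rfl, (Finset.mem_filter.1 hz).2, hmin x (by simpa using hx)⟩⟩
  choose y hy using h
  choose g hg using fun x => hy (c x) x rfl
  refine ⟨g, fun x => (hg x).2.1, fun x x' hxx => ?_, fun x => (hg x).2.2⟩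
  have h1 := (hg x).1
  rw [hxx, (hg x').1] at h1
  exact (Option.some.inj h1).symm

theorem two_mul_card_image_le {X E : Type*} [Fintype X] [DecidableEq E] (c : X → E)
    (hc : ∀ e, Even (mult c e)) : 2 * (Finset.univ.image c).card ≤ Fintype.card X := by
  classical
  rw [← Finset.card_univ (α := X), mul_comm]
  rw [Finset.card_eq_sum_card_image c Finset.univ, ← smul_eq_mul, ← Finset.sum_const]
  refine Finset.sum_le_sum fun e he => ?_
  obtain ⟨x, _, rfl⟩ := Finset.mem_image.1 he
  have h1 : 0 < mult c (c x) := Finset.card_pos.2 ⟨x, by simp⟩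
  obtain ⟨r, hr⟩ := hc (c x)
  change 2 ≤ mult c (c x)
  omega

/-- The bound on the expected trace obtained by counting walks by the positions of the first
occurrences of their clauses. -/
noncomputable def walkBound (n d h L : ℕ) (p : ℝ) : ℝ :=
  ∑ N : Finset (Fin L × Fin d), if 2 * N.card ≤ L * d then
    ((L * d : ℕ) : ℝ) ^ (L * d - N.card) * (p ^ N.card * ((n : ℝ) ^ (h * N.card) *
      ∏ i, ((h * (Finset.univ.filter fun s => (i, s) ∈ N).card).factorial : ℝ))) else 0

/-- The total moment bound of the walks whose histograms are determined step by step. -/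
theorem sum_momentBound_le {n d h L : ℕ} {p : ℝ} (hp : 0 ≤ p) (b : Fin L × Fin d → Bool)
    (C : Finset (Fin L → Fin d → (Fin h → Fin n) × (Fin h → Fin n)))
    (hC : ∀ i, ∀ w ∈ C, ∀ w' ∈ C, (∀ j < i, w j = w' j) →
      halfHist (fun s => b (i, s)) (w i) = halfHist (fun s => b (i, s)) (w' i)) :
    ∑ w ∈ C, momentBound p (fun x : Fin L × Fin d => w x.1 x.2) ≤
      walkBound n d h L p := by
  classical
  rw [walkBound]
  let Good : (Fin L → Fin d → (Fin h → Fin n) × (Fin h → Fin n)) → Finset (Fin L × Fin d) →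
      (Fin L × Fin d → Fin L × Fin d) → Prop := fun w N g =>
    ∀ x, w x.1 x.2 = w (g x).1 (g x).2 ∧ g x ∈ N ∧ (g x).1 ≤ x.1
  -- Representative maps fix `N` pointwise, so only the positions outside `N` are free, with `L * d`
  -- choices each.
  let codes : Finset (Fin L × Fin d) → Finset (Fin L × Fin d → Fin L × Fin d) := fun N =>
    Fintype.piFinset fun x => if x ∈ N then {x} else Finset.univ
  have hcodes : ∀ N, ((codes N).card : ℝ) = ((L * d : ℕ) : ℝ) ^ (L * d - N.card) := by
    intro N
    simp only [codes, Fintype.card_piFinset]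
    rw [Finset.prod_congr rfl (g := fun x => if x ∈ N then 1 else L * d)
      (fun x _ => by split_ifs <;> simp)]
    rw [Finset.prod_ite]
    simp only [Finset.prod_const, one_pow, one_mul]
    have : (Finset.univ.filter fun x => x ∉ N) = Nᶜ := by ext; simp
    rw [this, Finset.card_compl]
    simp
  calc ∑ w ∈ C, momentBound p (fun x : Fin L × Fin d => w x.1 x.2)
      ≤ ∑ w ∈ C, ∑ N : Finset (Fin L × Fin d), ∑ g ∈ codes N,
          if 2 * N.card ≤ L * d ∧ Good w N g then p ^ N.card else 0 := by
        refine Finset.sum_le_sum fun w _ => ?_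
        have hnn : ∀ N : Finset (Fin L × Fin d), ∀ g : Fin L × Fin d → Fin L × Fin d,
            0 ≤ if 2 * N.card ≤ L * d ∧ Good w N g then p ^ N.card else 0 := by
          intro N g; split_ifs <;> positivity
        have hnn' : ∀ N : Finset (Fin L × Fin d), 0 ≤ ∑ g ∈ codes N,
            if 2 * N.card ≤ L * d ∧ Good w N g then p ^ N.card else 0 :=
          fun N => Finset.sum_nonneg fun g _ => hnn N g
        rw [momentBound]
        split_ifs with heven
        -- An upper bound needs only one pair `(N, g)` per surviving walk; all other terms are
        -- nonnegative.
        · obtain ⟨g, hg1, hg2, hg3⟩ :=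
            exists_representatives fun x : Fin L × Fin d => w x.1 x.2
          set N : Finset (Fin L × Fin d) := Finset.univ.image g with hN
          have hNcard : N.card =
              (Finset.univ.image fun x : Fin L × Fin d => w x.1 x.2).card := by
            have : (Finset.univ.image fun x : Fin L × Fin d => w x.1 x.2) =
                N.image fun x => w x.1 x.2 := by
              rw [hN, Finset.image_image]
              exact Finset.image_congr fun x _ => (hg1 x).symm
            rw [this]
            refine (Finset.card_image_of_injOn ?_).symm
            intro x hx y hy hxy
            obtain ⟨x, _, rfl⟩ := Finset.mem_image.1 hx
            obtain ⟨y, _, rfl⟩ := Finset.mem_image.1 hy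
            exact hg2 _ _ (((hg1 x).symm.trans hxy).trans (hg1 y))
          have hle : 2 * N.card ≤ L * d := by
            rw [hNcard]
            simpa using two_mul_card_image_le _ heven
          have hgood : Good w N g := fun x =>
            ⟨(hg1 x).symm, Finset.mem_image_of_mem g (Finset.mem_univ x), hg3 x⟩
          have hmem : g ∈ codes N := by
            refine Fintype.mem_piFinset.2 fun x => ?_
            split_ifs with hx
            · obtain ⟨y, _, rfl⟩ := Finset.mem_image.1 hx
              exact Finset.mem_singleton.2 (hg2 _ _ (hg1 y))
            · exact Finset.mem_univ _
          refine le_trans ?_ (Finset.single_le_sum (fun N _ => hnn' N) (Finset.mem_univ N))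
          refine le_trans ?_ (Finset.single_le_sum (fun g _ => hnn N g) hmem)
          rw [if_pos ⟨hle, hgood⟩, hNcard]
        · exact Finset.sum_nonneg fun N _ => hnn' N
    _ = ∑ N : Finset (Fin L × Fin d), ∑ g ∈ codes N, ∑ w ∈ C,
          if 2 * N.card ≤ L * d ∧ Good w N g then p ^ N.card else 0 := by
        rw [Finset.sum_comm]
        exact Finset.sum_congr rfl fun N _ => Finset.sum_comm
    _ ≤ _ := by
        refine Finset.sum_le_sum fun N _ => ?_
        split_ifs with hN
        · rw [← hcodes N, ← nsmul_eq_mul, ← Finset.sum_const]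
          refine Finset.sum_le_sum fun g _ => ?_
          simp only [hN, true_and]
          rw [← Finset.sum_filter, Finset.sum_const, nsmul_eq_mul, mul_comm]
          refine mul_le_mul_of_nonneg_left ?_ (by positivity)
          have := card_walks_le b N g (C.filter fun w => Good w N g)
            (fun i w hw w' hw' => hC i w (Finset.mem_filter.1 hw).1 w' (Finset.mem_filter.1 hw').1)
            (fun w hw => (Finset.mem_filter.1 hw).2)
          exact_mod_cast this
        · simp [hN]

/-! ### Moments of the random clauses -/

theorem isProbabilityMeasure_clauseLaw {p : ℝ} (hp0 : 0 ≤ p) (hp1 : p ≤ 1) :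
    IsProbabilityMeasure (clauseLaw p) := by
  constructor
  simp only [clauseLaw, Measure.add_apply, Measure.smul_apply, measure_univ, smul_eq_mul, mul_one]
  rw [← ENNReal.ofReal_add (by norm_num) (by norm_num), ← ENNReal.ofReal_mul hp0,
    ← ENNReal.ofReal_add (by linarith) (by norm_num; exact hp0)]
  norm_num

instance : MeasurableSingletonClass (Option ℤˣ) := ⟨fun _ => trivial⟩

/-- The tensor entry of a single clause. -/
def clauseValue (o : Option ℤˣ) : ℝ :=
  match o with
  | none => 0
  | some η => ((η : ℤ) : ℝ)

theorem integral_clauseValue_pow {p : ℝ} (hp0 : 0 ≤ p) (hp1 : p ≤ 1) (m : ℕ) :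
    ∫ o, clauseValue o ^ m ∂(clauseLaw p) = if m = 0 then 1 else if Even m then p else 0 := by
  have hint : ∀ μ : Measure (Option ℤˣ), IsFiniteMeasure μ →
      Integrable (fun o => clauseValue o ^ m) μ := fun μ _ => Integrable.of_finite
  have hfin : ∀ (r : ℝ) (μ : Measure (Option ℤˣ)), IsFiniteMeasure μ →
      IsFiniteMeasure (ENNReal.ofReal r • μ) :=
    fun r μ _ => Measure.smul_finite μ ENNReal.ofReal_ne_top
  have hadd : IsFiniteMeasure (ENNReal.ofReal (1 / 2) • Measure.dirac (some (1 : ℤˣ)) +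
      ENNReal.ofReal (1 / 2) • Measure.dirac (some (-1 : ℤˣ))) := by
    have h1 := hfin (1 / 2) (Measure.dirac (some (1 : ℤˣ))) inferInstance
    have h2 := hfin (1 / 2) (Measure.dirac (some (-1 : ℤˣ))) inferInstance
    infer_instance
  rw [clauseLaw, integral_add_measure (hint _ (hfin _ _ inferInstance))
    (hint _ (hfin _ _ hadd)), integral_smul_measure, integral_smul_measure,
    integral_add_measure (hint _ (hfin _ _ inferInstance))
    (hint _ (hfin _ _ inferInstance)), integral_smul_measure, integral_smul_measure,
    integral_dirac, integral_dirac, integral_dirac, ENNReal.toReal_ofReal (by linarith),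
    ENNReal.toReal_ofReal hp0, ENNReal.toReal_ofReal (by norm_num)]
  simp only [clauseValue, smul_eq_mul]
  rcases eq_or_ne m 0 with rfl | hm
  · norm_num
  · rcases Nat.even_or_odd m with he | ho
    · simp [hm, he]; ring
    · simp [hm, ho.neg_one_pow, Nat.not_even_iff_odd.2 ho]

/-- Grouping the factors by tuple, independence splits the integral into single-clause moments: `1`
for an absent tuple, `p` for an even multiplicity, `0` for an odd one. -/
theorem integral_prod_tensor {n k : ℕ} {p : ℝ} (hp0 : 0 ≤ p) (hp1 : p ≤ 1) {X : Type*} [Fintype X]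
    (c : X → Fin k → Fin n) :
    ∫ Φ, ∏ x, tensor Φ (c x) ∂(randomXOR n k p) = momentBound p c := by
  classical
  have hprob := isProbabilityMeasure_clauseLaw hp0 hp1
  have h1 : ∀ Φ : XORInstance n k, ∏ x, tensor Φ (c x) =
      ∏ S : Fin k → Fin n, clauseValue (Φ S) ^ mult c S := by
    intro Φ
    rw [← Finset.prod_fiberwise (s := Finset.univ) (g := c)]
    refine Finset.prod_congr rfl fun S _ => ?_
    rw [mult, ← Finset.prod_const]
    refine Finset.prod_congr rfl fun x hx => ?_
    rw [(Finset.mem_filter.1 hx).2]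
    rfl
  simp_rw [h1]
  rw [randomXOR, integral_fintype_prod_eq_prod (fun S o => clauseValue o ^ mult c S)]
  simp_rw [integral_clauseValue_pow hp0 hp1]
  rw [momentBound]
  split_ifs with h
  · rw [Finset.prod_congr rfl (g := fun S => if S ∈ Finset.univ.image c then p else 1)]
    · rw [Finset.prod_ite_mem, Finset.univ_inter, Finset.prod_const]
    · intro S _
      have : mult c S = 0 ↔ S ∉ Finset.univ.image c := by
        simp [mult, Finset.card_eq_zero, Finset.filter_eq_empty_iff]
      by_cases hS : S ∈ Finset.univ.image c
      · rw [if_neg (fun h0 => this.1 h0 hS), if_pos (h S), if_pos hS]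
      · rw [if_pos (this.2 hS), if_neg hS]
  · push Not at h
    obtain ⟨S, hS⟩ := h
    refine Finset.prod_eq_zero (Finset.mem_univ S) ?_
    rw [if_neg (fun h0 => hS (by rw [h0]; exact Even.zero)), if_neg hS]

/-- Lets walks be counted with clauses as pairs of halves although the tensor is indexed by their
concatenation. -/
theorem momentBound_comp {X E E' : Type*} [Fintype X] [DecidableEq E] [DecidableEq E'] (p : ℝ)
    (c : X → E) {f : E → E'} (hf : Function.Injective f) :
    momentBound p (fun x => f (c x)) = momentBound p c := by
  classical
  have h1 : ∀ e, mult (fun x => f (c x)) (f e) = mult c e := by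
    intro e
    simp [mult, hf.eq_iff]
  have h2 : (∀ e, Even (mult (fun x => f (c x)) e)) ↔ ∀ e, Even (mult c e) := by
    refine ⟨fun h e => h1 e ▸ h (f e), fun h e => ?_⟩
    by_cases he : ∃ e', f e' = e
    · obtain ⟨e', rfl⟩ := he
      rw [h1]
      exact h e'
    · have : mult (fun x => f (c x)) e = 0 := by
        simp only [mult, Finset.card_eq_zero, Finset.filter_eq_empty_iff]
        exact fun x _ hx => he ⟨_, hx⟩
      rw [this]
      exact Even.zero
  have h3 : (Finset.univ.image fun x => f (c x)).card = (Finset.univ.image c).card := by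
    rw [← Finset.card_image_of_injective _ hf, Finset.image_image]
    rfl
  simp only [momentBound, h2, h3]

theorem concat_injective {n k : ℕ} (hk : Even k) :
    Function.Injective fun c : (Fin (k / 2) → Fin n) × (Fin (k / 2) → Fin n) =>
      concat hk c.1 c.2 := by
  rintro ⟨U, V⟩ ⟨U', V'⟩ h
  have hcast : k = k / 2 + k / 2 := by obtain ⟨r, rfl⟩ := hk; omega
  have h1 : Fin.append U V = Fin.append U' V' := by
    funext j
    have := congrFun h (Fin.cast hcast.symm j)
    simpa [concat] using this
  refine Prod.ext (funext fun j => ?_) (funext fun j => ?_)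
  · simpa using congrFun h1 (Fin.castAdd _ j)
  · simpa only [Fin.append_right] using congrFun h1 (Fin.natAdd _ j)

/-! ### Traces, walks and the spectral norm -/

theorem trace_mul_pow_comm {m l : Type*} [Fintype m] [Fintype l] [DecidableEq m] [DecidableEq l]
    (A : Matrix m l ℝ) (B : Matrix l m ℝ) (L : ℕ) :
    ((A * B) ^ (L + 1)).trace = ((B * A) ^ (L + 1)).trace := by
  have h : ∀ L : ℕ, A * (B * A) ^ L = (A * B) ^ L * A := by
    intro L
    induction L with
    | zero => simp
    | succ L ih => rw [pow_succ, ← Matrix.mul_assoc, ih, pow_succ]; simp only [Matrix.mul_assoc]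
  rw [pow_succ, ← Matrix.mul_assoc, ← h, Matrix.mul_assoc, Matrix.trace_mul_comm, Matrix.mul_assoc,
    ← pow_succ]

/-- Powers of a product of two matrices as a sum over walks. -/
theorem mul_pow_apply_eq_sum_walks {ι : Type*} [Fintype ι] [DecidableEq ι] (Q K : Matrix ι ι ℝ)
    (L : ℕ) (a z : ι) :
    ((Q * K) ^ L) a z = ∑ w : Fin L → ι × ι,
      (∏ i : Fin L, Q (Fin.cons (α := fun _ => ι) a (fun j => (w j).2) i.castSucc) (w i).1) *
        (∏ i, K (w i).1 (w i).2) *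
        if Fin.cons (α := fun _ => ι) a (fun j => (w j).2) (Fin.last L) = z then 1 else 0 := by
  induction L generalizing a with
  | zero => simp [Matrix.one_apply]
  | succ L ih =>
    rw [pow_succ', Matrix.mul_apply, ← (Fin.consEquiv fun _ => ι × ι).sum_comp,
      Fintype.sum_prod_type, Fintype.sum_prod_type_right]
    refine Finset.sum_congr rfl fun e _ => ?_
    rw [Matrix.mul_apply, Finset.sum_mul]
    refine Finset.sum_congr rfl fun c _ => ?_
    rw [ih, Finset.mul_sum]
    refine Finset.sum_congr rfl fun w _ => ?_
    have hcons : (fun j : Fin (L + 1) => ((Fin.consEquiv fun _ => ι × ι) ((c, e), w) j).2) =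
        Fin.cons (α := fun _ => ι) e fun j => (w j).2 := by
      funext j
      refine Fin.cases ?_ (fun j => ?_) j <;> simp [Fin.consEquiv]
    rw [hcons, Fin.prod_univ_succ, Fin.prod_univ_succ]
    have hlast : Fin.cons (α := fun _ => ι) a (Fin.cons (α := fun _ => ι) e fun j => (w j).2)
        (Fin.last (L + 1)) = Fin.cons (α := fun _ => ι) e (fun j => (w j).2) (Fin.last L) := by
      rw [← Fin.succ_last, Fin.cons_succ]
    rw [hlast]
    simp only [Fin.consEquiv, Equiv.coe_fn_mk, Fin.cons_zero, Fin.cons_succ, Fin.castSucc_zero,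
      ← Fin.succ_castSucc]
    ring

theorem spectralNorm_sq_le {ι : Type*} [Fintype ι] [DecidableEq ι] (A : Matrix ι ι ℝ) :
    spectralNorm A ^ 2 ≤ (A.transpose * A).trace := by
  have htr : (A.transpose * A).trace = ∑ i, ∑ j, A i j ^ 2 := by
    rw [Matrix.trace, Finset.sum_comm]
    simp [Matrix.mul_apply, sq]
  have hnn : 0 ≤ ∑ i, ∑ j, A i j ^ 2 := by positivity
  rw [htr]
  have h : spectralNorm A ≤ √(∑ i, ∑ j, A i j ^ 2) := by
    refine ContinuousLinearMap.opNorm_le_bound _ (Real.sqrt_nonneg _) fun x => ?_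
    rw [EuclideanSpace.norm_eq, EuclideanSpace.norm_eq, ← Real.sqrt_mul hnn]
    refine Real.sqrt_le_sqrt ?_
    rw [Finset.sum_mul]
    refine Finset.sum_le_sum fun i _ => ?_
    simp only [Real.norm_eq_abs, sq_abs]
    exact Finset.sum_mul_sq_le_sq_mul_sq _ _ _
  calc spectralNorm A ^ 2 ≤ √(∑ i, ∑ j, A i j ^ 2) ^ 2 :=
        pow_le_pow_left₀ (norm_nonneg _) h 2
    _ = _ := Real.sq_sqrt hnn

/-- For self-adjoint operators the norm commutes with repeated squaring, so the Frobenius bound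
applies to `A ^ 2 ^ m`. Restricting to powers of two avoids any diagonalization. -/
theorem spectralNorm_pow_le_trace {ι : Type*} [Fintype ι] [DecidableEq ι] (A : Matrix ι ι ℝ)
    (hA : A.transpose = A) (m : ℕ) :
    spectralNorm A ^ (2 ^ (m + 1)) ≤ (A ^ (2 ^ (m + 1))).trace := by
  have hsa : IsSelfAdjoint (Matrix.toEuclideanCLM (n := ι) (𝕜 := ℝ) A) := by
    have : IsSelfAdjoint A := by
      rw [IsSelfAdjoint, Matrix.star_eq_conjTranspose, Matrix.conjTranspose_eq_transpose_of_trivial,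
        hA]
    exact this.map _
  have h1 : spectralNorm (A ^ 2 ^ m) = spectralNorm A ^ 2 ^ m := by
    rw [spectralNorm, map_pow]
    exact hsa.norm_pow_two_pow m
  have h2 := spectralNorm_sq_le (A ^ 2 ^ m)
  rw [h1, Matrix.transpose_pow, hA, ← pow_mul, ← pow_add] at h2
  rw [pow_succ]
  convert h2 using 3
  ring

/-! ### The symmetrizer and its Gram matrix -/

theorem hist_comp_perm {n q : ℕ} (I : Fin q → Fin n) (π : Equiv.Perm (Fin q)) :
    hist (I ∘ π) = hist I := by
  funext i
  refine Finset.card_bij (fun j _ => π j) (by simp) (by simp) fun j hj => ⟨π.symm j, ?_, by simp⟩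
  simpa using hj

theorem histFactorial_pos {n q : ℕ} (I : Fin q → Fin n) : 0 < histFactorial I :=
  Finset.prod_pos fun _ _ => Nat.factorial_pos _

/-- The number of permutations carrying a tuple `I` to a given tuple is at most `hist(I)!`. -/
theorem card_perm_comp_eq_le {n q : ℕ} (I J : Fin q → Fin n) :
    (Finset.univ.filter fun π : Equiv.Perm (Fin q) => I ∘ π = J).card ≤ histFactorial I := by
  classical
  have hst : (Finset.univ.filter fun π : Equiv.Perm (Fin q) => I ∘ π = I).card =
      histFactorial I := by
    rw [← Fintype.card_subtype, DomMulAct.stabilizer_card I]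
    simp [histFactorial, hist, Fintype.card_subtype]
  rcases (Finset.univ.filter fun π : Equiv.Perm (Fin q) => I ∘ π = J).eq_empty_or_nonempty with
    h | ⟨π₀, h₀⟩
  · rw [h]; simp
  rw [← hst]
  -- A nonempty fibre is a coset of the stabilizer of `I`, which has order `hist(I)!`.
  refine Finset.card_le_card_of_injOn (fun π => π * π₀⁻¹) ?_ (fun _ _ _ _ h => mul_right_cancel h)
  intro π hπ
  simp only [Finset.mem_filter, Finset.mem_univ, true_and, Finset.coe_filter,
    Set.mem_ofPred_eq] at hπ h₀ ⊢
  rw [Equiv.Perm.coe_mul, ← Function.comp_assoc, hπ, ← h₀, Function.comp_assoc,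
    ← Equiv.Perm.coe_mul, mul_inv_cancel]
  rfl

/-- The symmetrization of tuples, divided by `√(hist(I)!)`. -/
noncomputable def symmetrizer (n q : ℕ) : Matrix (Fin q → Fin n) (Fin q → Fin n) ℝ :=
  Matrix.of fun I J => (√(histFactorial I : ℝ))⁻¹ * ((q.factorial : ℝ)⁻¹ *
    ∑ π : Equiv.Perm (Fin q), if I ∘ π = J then 1 else 0)

/-- The averages over `π` and `σ` act on rows and columns separately. In this form the trace depends
on the symmetrization only through its Gram matrix. -/
theorem rescaledRep_eq {n k : ℕ} (hk : Even k) (d : ℕ) (Φ : XORInstance n k) :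
    rescaledRep hk d Φ = symmetrizer n (d * (k / 2)) * kroneckerPow hk d Φ *
      (symmetrizer n (d * (k / 2))).transpose := by
  have hinv : (histDiag n (d * (k / 2)))⁻¹ =
      Matrix.diagonal fun I : Fin (d * (k / 2)) → Fin n => (√(histFactorial I : ℝ))⁻¹ := by
    refine Matrix.inv_eq_right_inv ?_
    rw [histDiag, Matrix.diagonal_mul_diagonal, ← Matrix.diagonal_one]
    congr 1
    funext I
    exact mul_inv_cancel₀ (Real.sqrt_pos.2 (by exact_mod_cast histFactorial_pos I)).ne'
  rw [rescaledRep, hinv]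
  ext I J
  rw [Matrix.mul_diagonal, Matrix.diagonal_mul, higherSymRep]
  simp only [Matrix.mul_apply, Matrix.transpose_apply, symmetrizer, Matrix.of_apply]
  have h : ∀ J' : Fin (d * (k / 2)) → Fin n,
      (∑ I', (√(histFactorial I : ℝ))⁻¹ * (((d * (k / 2)).factorial : ℝ)⁻¹ *
        ∑ π : Equiv.Perm (Fin (d * (k / 2))), if I ∘ π = I' then 1 else 0) *
          kroneckerPow hk d Φ I' J') =
      (√(histFactorial I : ℝ))⁻¹ * (((d * (k / 2)).factorial : ℝ)⁻¹ *
        ∑ π : Equiv.Perm (Fin (d * (k / 2))), kroneckerPow hk d Φ (I ∘ π) J') := by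
    intro J'
    simp_rw [mul_assoc, ← Finset.mul_sum, Finset.sum_mul]
    rw [Finset.sum_comm]
    simp
  simp_rw [h]
  have h2 : ∀ G : (Fin (d * (k / 2)) → Fin n) → ℝ,
      (∑ J', G J' * ((√(histFactorial J : ℝ))⁻¹ * (((d * (k / 2)).factorial : ℝ)⁻¹ *
        ∑ σ : Equiv.Perm (Fin (d * (k / 2))), if J ∘ σ = J' then 1 else 0))) =
      (√(histFactorial J : ℝ))⁻¹ * (((d * (k / 2)).factorial : ℝ)⁻¹ *
        ∑ σ : Equiv.Perm (Fin (d * (k / 2))), G (J ∘ σ)) := by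
    intro G
    simp_rw [mul_left_comm (G _), ← Finset.mul_sum, Finset.mul_sum _ _ (G _)]
    rw [Finset.sum_comm]
    simp
  rw [h2]
  simp_rw [← Finset.mul_sum]
  rw [Finset.sum_comm]
  ring

theorem symmetrizer_gram_nonneg {n q : ℕ} (J J' : Fin q → Fin n) :
    0 ≤ ((symmetrizer n q).transpose * symmetrizer n q) J J' := by
  rw [Matrix.mul_apply]
  refine Finset.sum_nonneg fun I _ => ?_
  simp only [Matrix.transpose_apply, symmetrizer, Matrix.of_apply]
  positivity

theorem symmetrizer_gram_eq_zero {n q : ℕ} {J J' : Fin q → Fin n} (h : hist J' ≠ hist J) :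
    ((symmetrizer n q).transpose * symmetrizer n q) J J' = 0 := by
  rw [Matrix.mul_apply]
  refine Finset.sum_eq_zero fun I _ => ?_
  simp only [Matrix.transpose_apply, symmetrizer, Matrix.of_apply]
  by_cases h1 : hist I = hist J
  · have : (∑ π : Equiv.Perm (Fin q), if I ∘ π = J' then (1 : ℝ) else 0) = 0 := by
      refine Finset.sum_eq_zero fun π _ => if_neg ?_
      rintro rfl
      exact h (by rw [hist_comp_perm, h1])
    rw [this]; simp
  · have : (∑ π : Equiv.Perm (Fin q), if I ∘ π = J then (1 : ℝ) else 0) = 0 := by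
      refine Finset.sum_eq_zero fun π _ => if_neg ?_
      rintro rfl
      exact h1 (hist_comp_perm I π).symm
    rw [this]; simp

/-- Here the rescaling pays off: one permutation sum is at most `hist(I)!` and cancels the two
factors `1/√(hist(I)!)`. The other, summed over `I`, is exactly `q!`, as each `π` comes from one
`I`; this leaves `q!/(q!)²`. -/
theorem symmetrizer_gram_le {n q : ℕ} (J J' : Fin q → Fin n) :
    ((symmetrizer n q).transpose * symmetrizer n q) J J' ≤ (q.factorial : ℝ)⁻¹ := by
  rw [Matrix.mul_apply]
  have hq : (0 : ℝ) < q.factorial := by exact_mod_cast q.factorial_pos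
  have hterm : ∀ I : Fin q → Fin n,
      (symmetrizer n q).transpose J I * symmetrizer n q I J' ≤
        (q.factorial : ℝ)⁻¹ * (q.factorial : ℝ)⁻¹ *
          ∑ π : Equiv.Perm (Fin q), if I ∘ π = J then 1 else 0 := by
    intro I
    simp only [Matrix.transpose_apply, symmetrizer, Matrix.of_apply]
    have hpos : (0 : ℝ) < histFactorial I := by exact_mod_cast histFactorial_pos I
    have h1 : (∑ π : Equiv.Perm (Fin q), if I ∘ π = J' then (1 : ℝ) else 0) ≤ histFactorial I := by
      rw [Finset.sum_boole]
      exact_mod_cast card_perm_comp_eq_le I J'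
    have h0 : (0 : ℝ) ≤ ∑ π : Equiv.Perm (Fin q), if I ∘ π = J then (1 : ℝ) else 0 := by positivity
    set A := ∑ π : Equiv.Perm (Fin q), if I ∘ π = J then (1 : ℝ) else 0
    set B := ∑ π : Equiv.Perm (Fin q), if I ∘ π = J' then (1 : ℝ) else 0
    have hs : (√(histFactorial I : ℝ))⁻¹ * (√(histFactorial I : ℝ))⁻¹ =
        (histFactorial I : ℝ)⁻¹ := by
      rw [← mul_inv, Real.mul_self_sqrt hpos.le]
    calc _ = (q.factorial : ℝ)⁻¹ * (q.factorial : ℝ)⁻¹ * A *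
          (((√(histFactorial I : ℝ))⁻¹ * (√(histFactorial I : ℝ))⁻¹) * B) := by ring
      _ ≤ (q.factorial : ℝ)⁻¹ * (q.factorial : ℝ)⁻¹ * A * 1 := by
          refine mul_le_mul_of_nonneg_left ?_ (by positivity)
          rw [hs]
          calc _ ≤ (histFactorial I : ℝ)⁻¹ * histFactorial I :=
                mul_le_mul_of_nonneg_left h1 (by positivity)
            _ = 1 := inv_mul_cancel₀ hpos.ne'
      _ = _ := mul_one _
  refine (Finset.sum_le_sum fun I _ => hterm I).trans (le_of_eq ?_)
  rw [← Finset.mul_sum, Finset.sum_comm]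
  have h2 : ∀ π : Equiv.Perm (Fin q),
      (∑ I : Fin q → Fin n, if I ∘ π = J then (1 : ℝ) else 0) = 1 := by
    intro π
    have : ∀ I : Fin q → Fin n, I ∘ π = J ↔ I = J ∘ π.symm := fun I =>
      (Equiv.eq_comp_symm π I J).symm
    simp [this]
  simp [h2, Fintype.card_perm]
  field_simp

/-! ### Oriented walks and the expected trace -/

theorem kroneckerPow_transpose {n k : ℕ} (hk : Even k) (d : ℕ) (Φ : XORInstance n k) :
    (kroneckerPow hk d Φ).transpose = kroneckerPow hk d Φ := by
  ext I J
  simp [kroneckerPow, symRep, add_comm]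

theorem rescaledRep_transpose {n k : ℕ} (hk : Even k) (d : ℕ) (Φ : XORInstance n k) :
    (rescaledRep hk d Φ).transpose = rescaledRep hk d Φ := by
  rw [rescaledRep_eq, Matrix.transpose_mul, Matrix.transpose_mul, Matrix.transpose_transpose,
    kroneckerPow_transpose, Matrix.mul_assoc]

/-- The clauses traversed by a walk, with the orientations `β`. -/
def orientedClauses {n d h L : ℕ} (β : Fin L × Fin d → Bool)
    (w : Fin L → (Fin (d * h) → Fin n) × (Fin (d * h) → Fin n)) :
    Fin L → Fin d → (Fin h → Fin n) × (Fin h → Fin n) :=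
  fun i s => if β (i, s) then (block (w i).1 s, block (w i).2 s)
    else (block (w i).2 s, block (w i).1 s)

/-- Selecting by `β` undoes the swap by `β`, so constraints on row indices become constraints on
selected halves. -/
theorem half_orientedClauses {n d h L : ℕ} (β : Fin L × Fin d → Bool)
    (w : Fin L → (Fin (d * h) → Fin n) × (Fin (d * h) → Fin n)) (i : Fin L) (s : Fin d) :
    half (β (i, s)) (orientedClauses β w i s) = block (w i).1 s := by
  cases hb : β (i, s) <;> simp [half, orientedClauses, hb]

theorem half_not_orientedClauses {n d h L : ℕ} (β : Fin L × Fin d → Bool)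
    (w : Fin L → (Fin (d * h) → Fin n) × (Fin (d * h) → Fin n)) (i : Fin L) (s : Fin d) :
    half (!β (i, s)) (orientedClauses β w i s) = block (w i).2 s := by
  cases hb : β (i, s) <;> simp [half, orientedClauses, hb]

theorem block_injective {n d h : ℕ} {I J : Fin (d * h) → Fin n} (hIJ : block I = block J) :
    I = J := by
  funext x
  obtain ⟨⟨s, j⟩, rfl⟩ := finProdFinEquiv.surjective x
  exact congrFun (congrFun hIJ s) j

theorem orientedClauses_ext {n d h L : ℕ} (β : Fin L × Fin d → Bool)
    {w w' : Fin L → (Fin (d * h) → Fin n) × (Fin (d * h) → Fin n)} {i : Fin L}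
    (h : orientedClauses β w i = orientedClauses β w' i) : w i = w' i := by
  refine Prod.ext (block_injective ?_) (block_injective ?_)
  · funext s
    rw [← half_orientedClauses β w, ← half_orientedClauses β w', h]
  · funext s
    rw [← half_not_orientedClauses β w, ← half_not_orientedClauses β w', h]

theorem halfHist_orientedClauses {n d h L : ℕ} (β : Fin L × Fin d → Bool)
    (w : Fin L → (Fin (d * h) → Fin n) × (Fin (d * h) → Fin n)) (i : Fin L) :
    halfHist (fun s => β (i, s)) (orientedClauses β w i) = hist (w i).1 := by
  funext v
  simp only [halfHist, half_orientedClauses, hist, block]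
  rw [Finset.card_filter, ← finProdFinEquiv.sum_comp, Fintype.sum_prod_type]

/-- Each factor `(M + Mᵀ)/2` averages the two orientations of a clause; expanding the product gives
an average over all `β`. -/
theorem prod_kroneckerPow_eq {n k : ℕ} (hk : Even k) (d : ℕ) (Φ : XORInstance n k) {L : ℕ}
    (w : Fin L → (Fin (d * (k / 2)) → Fin n) × (Fin (d * (k / 2)) → Fin n)) :
    ∏ i, kroneckerPow hk d Φ (w i).1 (w i).2 = ∑ β : Fin L × Fin d → Bool,
      (1 / 2 : ℝ) ^ (L * d) * ∏ x : Fin L × Fin d, tensor Φ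
        (concat hk (orientedClauses β w x.1 x.2).1 (orientedClauses β w x.1 x.2).2) := by
  simp only [kroneckerPow, Matrix.of_apply]
  rw [← Fintype.prod_prod_type' (f := fun i s =>
    symRep hk Φ (block (w i).1 s) (block (w i).2 s))]
  have h : ∀ x : Fin L × Fin d, symRep hk Φ (block (w x.1).1 x.2) (block (w x.1).2 x.2) =
      ∑ b : Bool, (1 / 2 : ℝ) *
        if b then tensor Φ (concat hk (block (w x.1).1 x.2) (block (w x.1).2 x.2))
        else tensor Φ (concat hk (block (w x.1).2 x.2) (block (w x.1).1 x.2)) := by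
    intro x
    simp [symRep, flattening]
    ring
  simp_rw [h]
  rw [Finset.prod_univ_sum, Fintype.piFinset_univ]
  refine Finset.sum_congr rfl fun β _ => ?_
  rw [Finset.prod_mul_distrib]
  congr 1
  · simp
  · refine Finset.prod_congr rfl fun x _ => ?_
    cases hb : β x <;> simp [orientedClauses, hb]

theorem isProbabilityMeasure_randomXOR (n k : ℕ) {p : ℝ} (hp0 : 0 ≤ p) (hp1 : p ≤ 1) :
    IsProbabilityMeasure (randomXOR n k p) := by
  have := isProbabilityMeasure_clauseLaw hp0 hp1
  rw [randomXOR]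
  infer_instance

theorem momentBound_nonneg {X E : Type*} [Fintype X] [DecidableEq E] {p : ℝ} (hp : 0 ≤ p)
    (c : X → E) : 0 ≤ momentBound p c := by
  rw [momentBound]
  split_ifs <;> positivity

theorem trace_rescaledRep_pow {n k : ℕ} (hk : Even k) (d : ℕ) (Φ : XORInstance n k) (L : ℕ) :
    (rescaledRep hk d Φ ^ (L + 1)).trace =
      (((symmetrizer n (d * (k / 2))).transpose * symmetrizer n (d * (k / 2)) *
        kroneckerPow hk d Φ) ^ (L + 1)).trace := by
  rw [rescaledRep_eq, trace_mul_pow_comm, Matrix.mul_assoc]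

/-- Walks whose first coordinates have the histograms of the preceding second coordinates. -/
def IsChain {n q L : ℕ} (a : Fin q → Fin n) (w : Fin L → (Fin q → Fin n) × (Fin q → Fin n)) :
    Prop :=
  ∀ i : Fin L, hist (w i).1 =
    hist (Fin.cons (α := fun _ => Fin q → Fin n) a (fun j => (w j).2) i.castSucc)

theorem IsChain.hist_eq {n q L : ℕ} {a : Fin q → Fin n}
    {w w' : Fin L → (Fin q → Fin n) × (Fin q → Fin n)} (hw : IsChain a w) (hw' : IsChain a w')
    (i : Fin L) (h : ∀ j < i, w j = w' j) : hist (w i).1 = hist (w' i).1 := by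
  rw [hw i, hw' i]
  congr 1
  cases L with
  | zero => exact i.elim0
  | succ L =>
    refine Fin.cases (fun _ => rfl) (fun i h => ?_) i h
    rw [← Fin.succ_castSucc, Fin.cons_succ, Fin.cons_succ, h _ (Fin.castSucc_lt_succ)]

theorem prod_gram_le {n q L : ℕ} (a : Fin q → Fin n)
    (w : Fin L → (Fin q → Fin n) × (Fin q → Fin n)) :
    (∏ i : Fin L, ((symmetrizer n q).transpose * symmetrizer n q)
      (Fin.cons (α := fun _ => Fin q → Fin n) a (fun j => (w j).2) i.castSucc) (w i).1) ≤
      open Classical in if IsChain a w then ((q.factorial : ℝ)⁻¹) ^ L else 0 := by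
  split_ifs with h
  · refine (Finset.prod_le_prod (fun i _ => symmetrizer_gram_nonneg _ _)
      (fun i _ => symmetrizer_gram_le _ _)).trans (le_of_eq ?_)
    simp
  · simp only [IsChain, not_forall] at h
    obtain ⟨i, hi⟩ := h
    exact (Finset.prod_eq_zero (Finset.mem_univ i) (symmetrizer_gram_eq_zero hi)).le

theorem sum_chain_momentBound_le {n k d L : ℕ} (hk : Even k) {p : ℝ} (hp : 0 ≤ p)
    (β : Fin L × Fin d → Bool) (a : Fin (d * (k / 2)) → Fin n) :
    (∑ w : Fin L → (Fin (d * (k / 2)) → Fin n) × (Fin (d * (k / 2)) → Fin n),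
      open Classical in if IsChain a w then momentBound p (fun x : Fin L × Fin d =>
        concat hk (orientedClauses β w x.1 x.2).1 (orientedClauses β w x.1 x.2).2) else 0) ≤
      walkBound n d (k / 2) L p := by
  classical
  have hinj : Function.Injective (orientedClauses (n := n) (h := k / 2) β) := fun w w' h =>
    funext fun i => orientedClauses_ext β (congrFun h i)
  rw [← Finset.sum_filter]
  have := sum_momentBound_le hp β
    ((Finset.univ.filter fun w => IsChain a w).image (orientedClauses (n := n) (h := k / 2) β)) (by
      intro i c hc c' hc' hcc
      obtain ⟨w, hw, rfl⟩ := Finset.mem_image.1 hc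
      obtain ⟨w', hw', rfl⟩ := Finset.mem_image.1 hc'
      rw [halfHist_orientedClauses, halfHist_orientedClauses]
      exact (Finset.mem_filter.1 hw).2.hist_eq (Finset.mem_filter.1 hw').2 i
        fun j hj => orientedClauses_ext β (hcc j hj))
  rw [Finset.sum_image hinj.injOn] at this
  refine le_trans (le_of_eq (Finset.sum_congr rfl fun w _ => ?_)) this
  exact momentBound_comp p (fun x : Fin L × Fin d => orientedClauses β w x.1 x.2)
    (concat_injective hk)

/-- The condition that the walk closes up is dropped. Each of the `n ^ (d * (k / 2))` starting
tuples then gets the same bound, and the orientation weights sum to one. -/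
theorem integral_trace_le {n k d : ℕ} (hk : Even k) {p : ℝ} (hp0 : 0 ≤ p) (hp1 : p ≤ 1) (L : ℕ) :
    ∫ Φ, (rescaledRep hk d Φ ^ (L + 1)).trace ∂(randomXOR n k p) ≤
      (n : ℝ) ^ (d * (k / 2)) * ((((d * (k / 2)).factorial : ℝ)⁻¹) ^ (L + 1) *
        walkBound n d (k / 2) (L + 1) p) := by
  classical
  have hprob := isProbabilityMeasure_randomXOR n k hp0 hp1
  set q := d * (k / 2) with hq
  set F := symmetrizer n q with hF
  let coef : (Fin q → Fin n) → (Fin (L + 1) → (Fin q → Fin n) × (Fin q → Fin n)) → ℝ := fun a w =>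
    (∏ i : Fin (L + 1), (F.transpose * F)
      (Fin.cons (α := fun _ => Fin q → Fin n) a (fun j => (w j).2) i.castSucc) (w i).1) *
      if Fin.cons (α := fun _ => Fin q → Fin n) a (fun j => (w j).2) (Fin.last (L + 1)) = a
      then 1 else 0
  have hcoef : ∀ a w, coef a w ≤ if IsChain a w then ((q.factorial : ℝ)⁻¹) ^ (L + 1) else 0 := by
    intro a w
    have h0 : 0 ≤ ∏ i : Fin (L + 1), (F.transpose * F)
      (Fin.cons (α := fun _ => Fin q → Fin n) a (fun j => (w j).2) i.castSucc) (w i).1 :=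
      Finset.prod_nonneg fun i _ => symmetrizer_gram_nonneg _ _
    refine (mul_le_of_le_one_right h0 ?_).trans (prod_gram_le a w)
    split_ifs <;> norm_num
  have htr : ∀ Φ : XORInstance n k, (rescaledRep hk d Φ ^ (L + 1)).trace =
      ∑ a, ∑ w, ∑ β : Fin (L + 1) × Fin d → Bool, coef a w * ((1 / 2 : ℝ) ^ ((L + 1) * d) *
        ∏ x : Fin (L + 1) × Fin d, tensor Φ
          (concat hk (orientedClauses β w x.1 x.2).1 (orientedClauses β w x.1 x.2).2)) := by
    intro Φ
    rw [trace_rescaledRep_pow, Matrix.trace]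
    refine Finset.sum_congr rfl fun a _ => ?_
    rw [Matrix.diag_apply, mul_pow_apply_eq_sum_walks]
    refine Finset.sum_congr rfl fun w _ => ?_
    rw [prod_kroneckerPow_eq, ← hF, mul_right_comm, Finset.mul_sum]
  simp_rw [htr]
  rw [integral_finsetSum _ fun _ _ => Integrable.of_finite]
  have hbound : ∀ a : Fin q → Fin n,
      ∫ Φ, ∑ w, ∑ β : Fin (L + 1) × Fin d → Bool, coef a w * ((1 / 2 : ℝ) ^ ((L + 1) * d) *
        ∏ x : Fin (L + 1) × Fin d, tensor Φ (concat hk (orientedClauses β w x.1 x.2).1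
          (orientedClauses β w x.1 x.2).2)) ∂(randomXOR n k p) ≤
      ((q.factorial : ℝ)⁻¹) ^ (L + 1) * walkBound n d (k / 2) (L + 1) p := by
    intro a
    rw [integral_finsetSum _ fun _ _ => Integrable.of_finite]
    simp_rw [integral_finsetSum Finset.univ fun _ _ => Integrable.of_finite, integral_const_mul,
      integral_prod_tensor hp0 hp1]
    rw [Finset.sum_comm]
    calc _ ≤ ∑ β : Fin (L + 1) × Fin d → Bool,
          ((1 / 2 : ℝ) ^ ((L + 1) * d) * (((q.factorial : ℝ)⁻¹) ^ (L + 1) *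
            walkBound n d (k / 2) (L + 1) p)) := by
          refine Finset.sum_le_sum fun β _ => ?_
          refine le_trans ?_ (mul_le_mul_of_nonneg_left (mul_le_mul_of_nonneg_left
            (sum_chain_momentBound_le hk hp0 β a) (by positivity)) (by positivity))
          rw [Finset.mul_sum, Finset.mul_sum]
          refine Finset.sum_le_sum fun w _ => ?_
          have hm := momentBound_nonneg hp0 (fun x : Fin (L + 1) × Fin d =>
            concat hk (orientedClauses β w x.1 x.2).1 (orientedClauses β w x.1 x.2).2)
          rw [mul_left_comm]
          refine mul_le_mul_of_nonneg_left ?_ (by positivity)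
          refine (mul_le_mul_of_nonneg_right (hcoef a w) hm).trans (le_of_eq ?_)
          split_ifs <;> simp
      _ = _ := by
          rw [Finset.sum_const, nsmul_eq_mul, ← mul_assoc]
          simp
  refine (Finset.sum_le_sum fun a _ => hbound a).trans (le_of_eq ?_)
  rw [Finset.sum_const, nsmul_eq_mul]
  simp [hq]

/-! ### Estimating the walk bound -/

/-- Induction on `b`, each step costing `(1 + 1/(a+b))^b ≤ e`. -/
theorem factorial_mul_pow_le (a b : ℕ) :
    (a.factorial : ℝ) * ((a + b : ℕ) : ℝ) ^ b ≤ Real.exp 1 ^ b * ((a + b).factorial : ℝ) := by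
  induction b with
  | zero => simp
  | succ b ih =>
    have h1 : ((a + b + 1 : ℕ) : ℝ) ^ b ≤ Real.exp 1 * ((a + b : ℕ) : ℝ) ^ b := by
      rcases Nat.eq_zero_or_pos (a + b) with h0 | h0
      · obtain rfl : b = 0 := by omega
        have := Real.add_one_le_exp (1 : ℝ)
        simp
      · have hpos : (0 : ℝ) < ((a + b : ℕ) : ℝ) := by exact_mod_cast h0
        have h2 : ((a + b + 1 : ℕ) : ℝ) ≤
            Real.exp (1 / ((a + b : ℕ) : ℝ)) * ((a + b : ℕ) : ℝ) := by
          have := mul_le_mul_of_nonneg_right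
            (Real.add_one_le_exp (1 / ((a + b : ℕ) : ℝ))) hpos.le
          refine le_trans (le_of_eq ?_) this
          push_cast
          push_cast at hpos
          field_simp
          ring
        refine (pow_le_pow_left₀ (by positivity) h2 b).trans ?_
        rw [mul_pow, ← Real.exp_nat_mul]
        refine mul_le_mul_of_nonneg_right (Real.exp_le_exp.2 ?_) (by positivity)
        rw [mul_one_div, div_le_one hpos]
        push_cast
        linarith [Nat.cast_nonneg (α := ℝ) a]
    have e1 : ((a + (b + 1)).factorial : ℝ) = ((a + b + 1 : ℕ) : ℝ) * (a + b).factorial := by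
      rw [← add_assoc, Nat.factorial_succ]; push_cast; ring
    rw [e1]
    calc (a.factorial : ℝ) * ((a + (b + 1) : ℕ) : ℝ) ^ (b + 1)
        = ((a + b + 1 : ℕ) : ℝ) * (a.factorial * ((a + b + 1 : ℕ) : ℝ) ^ b) := by
          rw [← add_assoc, pow_succ]; ring
      _ ≤ ((a + b + 1 : ℕ) : ℝ) * (a.factorial * (Real.exp 1 * ((a + b : ℕ) : ℝ) ^ b)) := by
          gcongr
      _ = ((a + b + 1 : ℕ) : ℝ) * Real.exp 1 * (a.factorial * ((a + b : ℕ) : ℝ) ^ b) := by ring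
      _ ≤ ((a + b + 1 : ℕ) : ℝ) * Real.exp 1 * (Real.exp 1 ^ b * ((a + b).factorial : ℝ)) := by
          gcongr
      _ = _ := by rw [pow_succ]; ring

theorem factorial_div_factorial_le {a q : ℕ} (h : a ≤ q) (hq : 0 < q) :
    ((q.factorial : ℝ)⁻¹) * a.factorial ≤ (Real.exp 1 / q) ^ (q - a) := by
  have h1 := factorial_mul_pow_le a (q - a)
  rw [Nat.add_sub_cancel' h] at h1
  have hq' : (0 : ℝ) < (q : ℝ) := by exact_mod_cast hq
  have hf : (0 : ℝ) < q.factorial := by exact_mod_cast q.factorial_pos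
  rw [div_pow, inv_mul_le_iff₀ hf, ← mul_div_assoc, le_div_iff₀ (by positivity)]
  linarith

/-- The left side is `(XY)^a (Y²)^(m-a)`, and `Y² ≤ B X Y`. -/
theorem pow_mul_pow_le {X Y B : ℝ} (hX : 0 ≤ X) (hY : 0 ≤ Y) (hB : 1 ≤ B) (hYX : Y ≤ B * X)
    {a m : ℕ} (h : a ≤ m) : X ^ a * Y ^ (2 * m - a) ≤ (B * X * Y) ^ m := by
  obtain ⟨r, rfl⟩ := Nat.exists_eq_add_of_le h
  have e : 2 * (a + r) - a = a + 2 * r := by omega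
  rw [e]
  calc X ^ a * Y ^ (a + 2 * r) = (1 * X * Y) ^ a * (Y * Y) ^ r := by
        rw [pow_add, pow_mul, one_mul, mul_pow, sq]; ring
    _ ≤ (B * X * Y) ^ a * (B * X * Y) ^ r := by gcongr
    _ = _ := by rw [pow_add]

/-- Every `N` is bounded by the same quantity; the factor `4 ^ m` is the number `2 ^ (L * d)` of
sets `N`. -/
theorem walkBound_le {n d h L m : ℕ} {p : ℝ} (hp : 0 ≤ p) (hd : 0 < d) (hh : 0 < h)
    (hm : L * d = 2 * m) {B : ℝ} (hB : 1 ≤ B)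
    (hYX : (L * d : ℕ) * (Real.exp 1 / (d * h : ℕ)) ^ h ≤ B * ((n : ℝ) ^ h * p)) :
    (((d * h).factorial : ℝ)⁻¹) ^ L * walkBound n d h L p ≤
      (4 * (B * ((n : ℝ) ^ h * p) * ((L * d : ℕ) * (Real.exp 1 / (d * h : ℕ)) ^ h))) ^ m := by
  classical
  set X := (n : ℝ) ^ h * p with hX
  set Y := ((L * d : ℕ) : ℝ) * (Real.exp 1 / (d * h : ℕ)) ^ h with hY
  have hX0 : 0 ≤ X := by positivity
  have hY0 : 0 ≤ Y := by positivity
  rw [walkBound, Finset.mul_sum]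
  have hterm : ∀ N : Finset (Fin L × Fin d),
      (((d * h).factorial : ℝ)⁻¹) ^ L * (if 2 * N.card ≤ L * d then
        ((L * d : ℕ) : ℝ) ^ (L * d - N.card) * (p ^ N.card * ((n : ℝ) ^ (h * N.card) *
          ∏ i, ((h * (Finset.univ.filter fun s => (i, s) ∈ N).card).factorial : ℝ))) else 0) ≤
        (B * X * Y) ^ m := by
    intro N
    split_ifs with hN
    · have hfac : (((d * h).factorial : ℝ)⁻¹) ^ L *
          ∏ i : Fin L, ((h * (Finset.univ.filter fun s => (i, s) ∈ N).card).factorial : ℝ) ≤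
          ((Real.exp 1 / (d * h : ℕ)) ^ h) ^ (L * d - N.card) := by
        have hν : ∀ i : Fin L, (Finset.univ.filter fun s => (i, s) ∈ N).card ≤ d := fun i =>
          (Finset.card_le_univ _).trans (by simp)
        have e1 : (((d * h).factorial : ℝ)⁻¹) ^ L = ∏ _i : Fin L, (((d * h).factorial : ℝ)⁻¹) := by
          simp
        rw [e1, ← Finset.prod_mul_distrib]
        have e2 : L * d - N.card =
            ∑ i : Fin L, (d - (Finset.univ.filter fun s => (i, s) ∈ N).card) := by
          rw [Finset.sum_tsub_distrib _ fun i _ => hν i, ← card_eq_sum_card_section]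
          simp
        rw [e2, ← Finset.prod_pow_eq_pow_sum]
        refine Finset.prod_le_prod (fun i _ => by positivity) fun i _ => ?_
        refine (factorial_div_factorial_le (q := d * h) ?_ (Nat.mul_pos hd hh)).trans
          (le_of_eq ?_)
        · rw [mul_comm d h]
          exact Nat.mul_le_mul_left _ (hν i)
        · rw [← pow_mul, mul_comm d h, ← Nat.mul_sub]
      refine le_trans ?_ (pow_mul_pow_le hX0 hY0 hB hYX (a := N.card) (m := m) (by omega))
      calc _ = ((L * d : ℕ) : ℝ) ^ (L * d - N.card) * (p ^ N.card * ((n : ℝ) ^ (h * N.card))) *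
            ((((d * h).factorial : ℝ)⁻¹) ^ L *
              ∏ i : Fin L, ((h * (Finset.univ.filter fun s => (i, s) ∈ N).card).factorial : ℝ)) := by
            ring
        _ ≤ ((L * d : ℕ) : ℝ) ^ (L * d - N.card) * (p ^ N.card * ((n : ℝ) ^ (h * N.card))) *
            ((Real.exp 1 / (d * h : ℕ)) ^ h) ^ (L * d - N.card) :=
            mul_le_mul_of_nonneg_left hfac (by positivity)
        _ = X ^ N.card * Y ^ (2 * m - N.card) := by
            rw [hX, hY, ← hm, mul_pow, mul_pow, pow_mul]; ring
    · simp only [mul_zero]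
      positivity
  refine (Finset.sum_le_sum fun N _ => hterm N).trans (le_of_eq ?_)
  rw [Finset.sum_const, nsmul_eq_mul, Finset.card_univ, Fintype.card_finset, mul_pow 4]
  congr 1
  rw [Fintype.card_prod, Fintype.card_fin, Fintype.card_fin, hm, pow_mul]
  norm_num

/-! ### Tail bound and choice of parameters -/

/-- The tail bound obtained from the trace moment of order `2 ^ (m + 1)`. -/
theorem tail_le {n k d h : ℕ} (hk : Even k) {p : ℝ} (hp0 : 0 ≤ p) (hp1 : p ≤ 1) (hd : 0 < d)
    (hk2 : h = k / 2)
    (hh : 0 < h) (m : ℕ) {B t : ℝ} (hB : 1 ≤ B) (ht : 0 < t)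
    (hYX : (2 ^ (m + 1) * d : ℕ) * (Real.exp 1 / (d * h : ℕ)) ^ h ≤
      B * ((n : ℝ) ^ h * p)) :
    (t ^ 2) ^ (2 ^ m * d) * (randomXOR n k p).real
        {Φ | t < spectralNorm (rescaledRep hk d Φ) ^ (1 / (d : ℝ))} ≤
      (n : ℝ) ^ (d * h) * (4 * (B * ((n : ℝ) ^ h * p) *
        ((2 ^ (m + 1) * d : ℕ) * (Real.exp 1 / (d * h : ℕ)) ^ h))) ^ (2 ^ m * d) := by
  subst hk2
  have hprob := isProbabilityMeasure_randomXOR n k hp0 hp1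
  obtain ⟨L, hL⟩ : ∃ L, 2 ^ (m + 1) = L + 1 := 
    ⟨2 ^ (m + 1) - 1, (Nat.sub_add_cancel Nat.one_le_two_pow).symm⟩
  have hpow : (2 : ℕ) ^ (m + 1) * d = 2 * (2 ^ m * d) := by ring
  have htrace : ∀ Φ : XORInstance n k, 0 ≤ (rescaledRep hk d Φ ^ 2 ^ (m + 1)).trace := fun Φ =>
    le_trans (pow_nonneg (norm_nonneg _) _)
      (spectralNorm_pow_le_trace _ (rescaledRep_transpose hk d Φ) m)
  have hmarkov := mul_meas_ge_le_integral_of_nonneg (μ := randomXOR n k p)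
    (f := fun Φ => (rescaledRep hk d Φ ^ 2 ^ (m + 1)).trace) (ae_of_all _ htrace)
    Integrable.of_finite ((t ^ 2) ^ (2 ^ m * d))
  have hsub : {Φ : XORInstance n k | t < spectralNorm (rescaledRep hk d Φ) ^ (1 / (d : ℝ))} ⊆
      {Φ | (t ^ 2) ^ (2 ^ m * d) ≤ (rescaledRep hk d Φ ^ 2 ^ (m + 1)).trace} := by
    intro Φ hΦ
    rw [Set.mem_ofPred_eq] at hΦ ⊢
    refine le_trans ?_ (spectralNorm_pow_le_trace _ (rescaledRep_transpose hk d Φ) m)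
    have hnn : 0 ≤ spectralNorm (rescaledRep hk d Φ) := norm_nonneg _
    have h1 : t ^ d ≤ spectralNorm (rescaledRep hk d Φ) := by
      calc t ^ d ≤ (spectralNorm (rescaledRep hk d Φ) ^ (1 / (d : ℝ))) ^ d :=
            pow_le_pow_left₀ ht.le hΦ.le d
        _ = _ := by
            rw [one_div, Real.rpow_inv_natCast_pow hnn hd.ne']
    calc (t ^ 2) ^ (2 ^ m * d) = (t ^ d) ^ 2 ^ (m + 1) := by
          rw [← pow_mul, ← pow_mul]; congr 1; ring
      _ ≤ _ := pow_le_pow_left₀ (by positivity) h1 _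
  refine (mul_le_mul_of_nonneg_left (measureReal_mono hsub) (by positivity)).trans
    (hmarkov.trans ?_)
  rw [hL] at hYX ⊢
  refine (integral_trace_le hk hp0 hp1 L).trans (mul_le_mul_of_nonneg_left ?_ (by positivity))
  refine walkBound_le hp0 hd hh (by rw [← hL, hpow]) hB hYX

theorem exp_one_div_pow_le {h : ℕ} (hh : 0 < h) : (Real.exp 1 / (h : ℝ)) ^ h ≤ Real.exp 1 := by
  have hpos : (0 : ℝ) < h := by exact_mod_cast hh
  have h1 : Real.exp 1 / (h : ℝ) ≤ Real.exp (1 / (h : ℝ)) := by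
    have h2 := Real.add_one_le_exp (1 / (h : ℝ) - 1)
    rw [sub_add_cancel, Real.exp_sub, le_div_iff₀ (Real.exp_pos 1)] at h2
    calc _ = 1 / (h : ℝ) * Real.exp 1 := by ring
      _ ≤ _ := h2
  calc _ ≤ Real.exp (1 / (h : ℝ)) ^ h := pow_le_pow_left₀ (by positivity) h1 h
    _ = Real.exp 1 := by
        rw [← Real.exp_nat_mul]
        congr 1
        field_simp

theorem exists_two_pow_near_log {n : ℕ} (hn : 2 ≤ n) :
    ∃ m : ℕ, Real.log n ≤ (2 : ℝ) ^ m ∧ (2 : ℝ) ^ m ≤ 2 * Real.log n := by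
  have hlog : 1 / 2 < Real.log n := by
    have h1 : Real.log 2 ≤ Real.log n := Real.log_le_log (by norm_num) (by exact_mod_cast hn)
    linarith [Real.log_two_gt_d9]
  have hex : ∃ m : ℕ, Real.log n ≤ (2 : ℝ) ^ m :=
    (pow_unbounded_of_one_lt (Real.log n) (by norm_num : (1 : ℝ) < 2)).imp fun _ h => h.le
  classical
  refine ⟨Nat.find hex, Nat.find_spec hex, ?_⟩
  rcases hm : Nat.find hex with _ | m
  -- Minimality says nothing at `m = 0`; there `log n > 1/2` is what is needed.
  · rw [pow_zero]; linarith
  · have := Nat.find_min hex (m := m) (by omega)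
    rw [pow_succ]
    linarith [not_le.1 this]

theorem sq_target_eq {n k d : ℕ} {h : ℕ} {p : ℝ} (hk : (k : ℝ) = 2 * h) (hh : 0 < h) (hp : 0 ≤ p)
    (c l : ℝ) :
    (c * (Real.exp (3 * (k : ℝ) / 4) / ((k : ℝ) / 2) ^ ((k : ℝ) / 4)) *
      ((n : ℝ) ^ ((k : ℝ) / 4) * p ^ ((1 : ℝ) / 2) / (d : ℝ) ^ (((k : ℝ) - 2) / 4)) * l) ^ 2 =
    c ^ 2 * (Real.exp 1 ^ (3 * h) / (h : ℝ) ^ h) * ((n : ℝ) ^ h * p / (d : ℝ) ^ (h - 1)) *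
      l ^ 2 := by
  have e1 : Real.exp (3 * (k : ℝ) / 4) ^ 2 = Real.exp 1 ^ (3 * h) := by
    rw [← Real.exp_nat_mul, ← Real.exp_nat_mul]
    congr 1
    rw [hk]; push_cast; ring
  have e2 : ∀ x : ℝ, 0 ≤ x → (x ^ ((k : ℝ) / 4)) ^ 2 = x ^ h := by
    intro x hx
    rw [← Real.rpow_mul_natCast hx, ← Real.rpow_natCast]
    congr 1
    rw [hk]; push_cast; ring
  have e3 : ((d : ℝ) ^ (((k : ℝ) - 2) / 4)) ^ 2 = (d : ℝ) ^ (h - 1) := by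
    rw [← Real.rpow_mul_natCast (Nat.cast_nonneg d), ← Real.rpow_natCast, Nat.cast_sub hh]
    congr 1
    rw [hk]; push_cast; ring
  have e4 : (p ^ ((1 : ℝ) / 2)) ^ 2 = p := by
    rw [← Real.rpow_mul_natCast hp]; norm_num
  have e5 : (k : ℝ) / 2 = h := by rw [hk]; ring
  rw [mul_pow, mul_pow, mul_pow, div_pow, div_pow, mul_pow, e1, e2 _ (by positivity),
    e2 _ (Nat.cast_nonneg n), e3, e4, e5]

end KXOR

theorem mainTheorem2 :
    ∃ c : ℝ, 0 < c ∧
      ∀ (k : ℕ) (hk : Even k) (d n : ℕ) (p : ℝ), 1 ≤ d → 0 ≤ p → p ≤ 1 →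
        1 < (d : ℝ) ^ ((k : ℝ) / 2 - 1) * (n : ℝ) ^ ((k : ℝ) / 2) * p →
        1 - ((n : ℝ) ^ 2)⁻¹ ≤
          (KXOR.randomXOR n k p).real
            {Φ : KXOR.XORInstance n k |
              KXOR.spectralNorm (KXOR.rescaledRep hk d Φ) ^ (1 / (d : ℝ)) ≤
                c * (Real.exp (3 * (k : ℝ) / 4) / ((k : ℝ) / 2) ^ ((k : ℝ) / 4)) *
                  ((n : ℝ) ^ ((k : ℝ) / 4) * p ^ ((1 : ℝ) / 2) /
                    (d : ℝ) ^ (((k : ℝ) - 2) / 4)) *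
                  Real.log n} := by
  refine ⟨8 * Real.exp 1 ^ 2, by positivity, ?_⟩
  intro k hk d n p hd hp0 hp1 hyp
  have hprob := KXOR.isProbabilityMeasure_randomXOR n k hp0 hp1
  obtain ⟨h, hh⟩ : ∃ h, h = k / 2 := ⟨_, rfl⟩
  have hkh : (k : ℝ) = 2 * h := by
    have : k = 2 * h := by obtain ⟨r, rfl⟩ := hk; omega
    exact_mod_cast this
  have hd0 : (0 : ℝ) < d := by exact_mod_cast hd
  have hd1 : (1 : ℝ) ≤ d := by exact_mod_cast hd
  have hk2 : (k : ℝ) / 2 = h := by rw [hkh]; ring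
  have hhpos : 0 < h := by
    rcases Nat.eq_zero_or_pos h with h0 | h0
    -- The case `k = 0` contradicts the density hypothesis, which would read `d⁻¹ * p > 1`.
    · rw [hk2, h0] at hyp
      simp only [Nat.cast_zero, zero_sub, Real.rpow_zero, mul_one, Real.rpow_neg_one] at hyp
      have h1 : (d : ℝ)⁻¹ ≤ 1 := inv_le_one_of_one_le₀ hd1
      have := mul_le_mul h1 hp1 hp0 zero_le_one
      linarith
    · exact h0
  have hyp' : 1 < (d : ℝ) ^ (h - 1) * ((n : ℝ) ^ h * p) := by
    rw [hk2, ← Nat.cast_one, ← Nat.cast_sub hhpos, Real.rpow_natCast, Real.rpow_natCast,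
      Nat.cast_one, mul_assoc] at hyp
    exact hyp
  have hX : 0 < (n : ℝ) ^ h * p := by
    by_contra hX
    have : (d : ℝ) ^ (h - 1) * ((n : ℝ) ^ h * p) ≤ 0 :=
      mul_nonpos_of_nonneg_of_nonpos (by positivity) (not_lt.1 hX)
    linarith
  rcases Nat.lt_or_ge n 2 with hn | hn
  -- For `n = 1` the claimed probability is at least `0`, so nothing is to be shown.
  · have : n = 1 := by
      rcases Nat.eq_zero_or_pos n with h0 | h0
      · rw [h0, Nat.cast_zero, zero_pow hhpos.ne', zero_mul] at hX
        exact absurd hX (lt_irrefl _)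
      · omega
    rw [this]
    norm_num
  obtain ⟨m, hm1, hm2⟩ := KXOR.exists_two_pow_near_log hn
  have hlog : 0 < Real.log n := Real.log_pos (by exact_mod_cast hn)
  have hppos : 0 < p := pos_of_mul_pos_right hX (by positivity)
  have hnpos : (0 : ℝ) < n := by exact_mod_cast (by omega : 0 < n)
  set t := 8 * Real.exp 1 ^ 2 * (Real.exp (3 * (k : ℝ) / 4) / ((k : ℝ) / 2) ^ ((k : ℝ) / 4)) *
    ((n : ℝ) ^ ((k : ℝ) / 4) * p ^ ((1 : ℝ) / 2) / (d : ℝ) ^ (((k : ℝ) - 2) / 4)) * Real.log n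
    with ht
  have hhR : (0 : ℝ) < h := by exact_mod_cast hhpos
  have htpos : 0 < t := by
    have : (0 : ℝ) < (k : ℝ) / 2 := by rw [hk2]; exact hhR
    positivity
  have htsq := KXOR.sq_target_eq (n := n) (d := d) hkh hhpos hp0 (8 * Real.exp 1 ^ 2) (Real.log n)
  rw [← ht] at htsq
  clear_value t
  have hdpow : (d : ℝ) ^ h = (d : ℝ) ^ (h - 1) * d := by
    rw [← pow_succ, Nat.sub_add_cancel hhpos]
  have hY : ((2 ^ (m + 1) * d : ℕ) : ℝ) * (Real.exp 1 / (d * h : ℕ)) ^ h =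
      2 ^ (m + 1) * (Real.exp 1 / h) ^ h / (d : ℝ) ^ (h - 1) := by
    push_cast
    rw [div_pow, div_pow, mul_pow, hdpow]
    field_simp
  have he1 : (1 : ℝ) ≤ Real.exp 1 := by linarith [Real.add_one_le_exp (1 : ℝ)]
  -- This `B` works because `Y = 2^(m+1) (e/h)^h / d^(h-1)`, where `(e/h)^h ≤ e` and `1/d^(h-1) <
  -- n^h p`.
  have hB : 1 ≤ Real.exp 1 * (2 : ℝ) ^ (m + 1) := one_le_mul_of_one_le_of_one_le he1
    (one_le_pow₀ (by norm_num))
  have htail := KXOR.tail_le (n := n) hk hp0 hp1 hd hh hhpos m hB htpos (by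
    rw [hY, div_le_iff₀ (by positivity)]
    calc 2 ^ (m + 1) * (Real.exp 1 / h) ^ h ≤ 2 ^ (m + 1) * Real.exp 1 :=
          mul_le_mul_of_nonneg_left (KXOR.exp_one_div_pow_le hhpos) (by positivity)
      _ ≤ 2 ^ (m + 1) * Real.exp 1 * ((d : ℝ) ^ (h - 1) * ((n : ℝ) ^ h * p)) :=
          le_mul_of_one_le_right (by positivity) hyp'.le
      _ = _ := by ring)
  rw [hY] at htail
  -- Of the `e^(3h)` in `t²`, `e^h` matches `(e/h)^h`; the remaining `e^(2h)`, with `e²` from the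
  -- constant, is slack to absorb the number of starting tuples. The `64` in `c² = 64 e⁴` is `16`
  -- times the `4` from `2^m ≤ 2 log n`.
  have hbase : 4 * (Real.exp 1 * (2 : ℝ) ^ (m + 1) * ((n : ℝ) ^ h * p) *
      (2 ^ (m + 1) * (Real.exp 1 / h) ^ h / (d : ℝ) ^ (h - 1))) ≤
      (Real.exp 1 ^ (2 * h + 2))⁻¹ * t ^ 2 := by
    have hsq : ((2 : ℝ) ^ m) ^ 2 ≤ (2 * Real.log n) ^ 2 := pow_le_pow_left₀ (by positivity) hm2 2
    have hx : 0 < (n : ℝ) ^ h * p / (d : ℝ) ^ (h - 1) * (Real.exp 1 ^ h / (h : ℝ) ^ h) := by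
      positivity
    calc _ = 16 * Real.exp 1 * ((n : ℝ) ^ h * p / (d : ℝ) ^ (h - 1) *
          (Real.exp 1 ^ h / (h : ℝ) ^ h)) * ((2 : ℝ) ^ m) ^ 2 := by
          rw [div_pow, pow_succ]; ring
      _ ≤ 16 * Real.exp 1 * ((n : ℝ) ^ h * p / (d : ℝ) ^ (h - 1) *
          (Real.exp 1 ^ h / (h : ℝ) ^ h)) * (2 * Real.log n) ^ 2 := by gcongr
      _ = 64 * Real.exp 1 * ((n : ℝ) ^ h * p / (d : ℝ) ^ (h - 1) *
          (Real.exp 1 ^ h / (h : ℝ) ^ h)) * Real.log n ^ 2 := by ring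
      _ ≤ 64 * Real.exp 1 ^ 2 * ((n : ℝ) ^ h * p / (d : ℝ) ^ (h - 1) *
          (Real.exp 1 ^ h / (h : ℝ) ^ h)) * Real.log n ^ 2 := by
          gcongr
          exact le_self_pow₀ he1 (by norm_num)
      _ = _ := by
          have : Real.exp 1 ^ (3 * h) = Real.exp 1 ^ (2 * h) * Real.exp 1 ^ h := by
            rw [← pow_add]; congr 1; ring
          rw [htsq, this, pow_add]
          field_simp
          norm_num
  have hfail : (KXOR.randomXOR n k p).real
      {Φ | t < KXOR.spectralNorm (KXOR.rescaledRep hk d Φ) ^ (1 / (d : ℝ))} ≤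
      ((n : ℝ) ^ 2)⁻¹ := by
    have h1 := htail.trans (mul_le_mul_of_nonneg_left
      (pow_le_pow_left₀ (by positivity) hbase (2 ^ m * d)) (by positivity))
    rw [mul_pow, mul_left_comm, ← mul_assoc, mul_comm] at h1
    have h2 := le_of_mul_le_mul_right h1 (by positivity)
    refine h2.trans ?_
    have hnexp : (n : ℝ) ≤ Real.exp 1 ^ 2 ^ m := by
      rw [← Real.exp_nat_mul, ← Real.log_le_iff_le_exp hnpos]
      push_cast
      linarith
    have hn1 : (1 : ℝ) ≤ n := by exact_mod_cast (by omega : 1 ≤ n)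
    rw [inv_pow, ← pow_mul, inv_mul_le_iff₀ (by positivity), ← div_eq_mul_inv,
      le_div_iff₀ (by positivity), ← pow_add]
    -- `n^(dh)` counts starting tuples and `n²` is the desired failure rate; since `n ≤ e^(2^m)`,
    -- the slack raised to the power `2^m * d` covers both.
    calc (n : ℝ) ^ (d * h + 2) ≤ (n : ℝ) ^ (d * (2 * h + 2)) :=
          pow_le_pow_right₀ hn1 (by nlinarith)
      _ ≤ (Real.exp 1 ^ 2 ^ m) ^ (d * (2 * h + 2)) := pow_le_pow_left₀ hnpos.le hnexp _
      _ = _ := by rw [← pow_mul]; congr 1; ring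
  have hcompl : {Φ : KXOR.XORInstance n k |
      KXOR.spectralNorm (KXOR.rescaledRep hk d Φ) ^ (1 / (d : ℝ)) ≤ t} =
      {Φ | t < KXOR.spectralNorm (KXOR.rescaledRep hk d Φ) ^ (1 / (d : ℝ))}ᶜ := by
    ext Φ
    simp
  rw [hcompl, probReal_compl_eq_one_sub (Set.toFinite _).measurableSet]
  linarith
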